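/- **Central limit theorem.** Let $d\ge 1$, let $\mathbb{R}^d$ be equipped with the metric $\rho$ of some norm, and let $D\subset\mathbb{R}^d$ be a countably infinite set such that $\rho(i,j)\ge\rho_0$ for all distinct $i,j\in D$, for some $\rho_0>0$. Let $D_n\subset D$ ($n\ge 1$) be finite sets with $|D_n|\to\infty$. For each $n$ let $(X_{i,n})_{i\in D_n}$ be zero-mean real-valued random variables on a common probability space (which may depend on $n$; no stationarity is assumed). *Dependence coefficients.* For $f:\mathbb{R}^u\to\mathbb{R}$ let $\mathrm{Lip}(f)=\sup_{x\ne y}|f(x)-f(y)|/\sum_k|x_k-y_k|$. For finite $U,V\subset D_n$ write $X_U=(X_{i,n})_{i\in U}$, $\rho(U,V)=\min_{i\in U,j\in V}\rho(i,j)$ (so that $\rho(U,V)\ge s$ holds trivially if $U$ or $V$ is empty), and let $\|f\|_\infty=\inf\{C>0:\mathbb{P}(|f(X_U)|\le C)=1\}$, $\|g\|_\infty=\inf\{C>0:\mathbb{P}(|g(X_V)|\le C)=1\}$. Define $$\bar\theta_{u,v}(s)=\sup\frac{|\mathrm{Cov}(f(X_U),g(X_V))|}{v\,\|f\|_\infty\mathrm{Lip}(g)},\qquad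 \bar\eta_{u,v}(s)=\sup\frac{|\mathrm{Cov}(f(X_U),g(X_V))|}{u\,\|g\|_\infty\mathrm{Lip}(f)+v\,\|f\|_\infty\mathrm{Lip}(g)},$$ where the suprema run over all $n$, all $U,V\subset D_n$ with $|U|=u$, $|V|=v$, $\rho(U,V)\ge s$, and, for $\bar\theta$, all measurable $f:\mathbb{R}^u\to\mathbb{R}$ with $\|f\|_\infty<\infty$ and all $g:\mathbb{R}^v\to\mathbb{R}$ with $\mathrm{Lip}(g)<\infty$; for $\bar\eta$, all $f,g$ with $\|f\|_\infty,\|g\|_\infty,\mathrm{Lip}(f),\mathrm{Lip}(g)<\infty$ (with $0/0=0$ and the supremum of the empty set equal to $0$). *Assumptions.* Let $m>2$, let $c_{i,n}>0$ ($i\in D_n$, $n\ge1$) be constants, and put $M_n=\sup_{i\in D_n}c_{i,n}$, $S_n=\sum_{i\in D_n}X_{i,n}$, $\sigma_n^2=\mathrm{Var}(S_n)$. Assume: 1. $\sup_n\sup_{i\in D_n}\mathbb{E}|X_{i,n}/c_{i,n}|^m<\infty$; 2. $\liminf_{n\to\infty}M_n>0$ (the $M_n$ may be unbounded); 3. $\liminf_{n\to\infty}|D_n|^{-1}M_n^{-2}\sigma_n^2>0$;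 4. at least one of the following holds as $s\to\infty$: - ($\theta$) $\bar\theta_{u,v}(s)=O(s^{-\alpha})$ for all $u+v\le 4$, for some $\alpha>\frac{m-1}{m-2}d$, and $\sup_u\bar\theta_{u,1}(s)=O(s^{-\beta})$ for some $\beta>d$; - ($\eta$) $\bar\eta_{u,v}(s)=O(s^{-\alpha})$ for all $u+v\le 4$, for some $\alpha>\frac{m-1}{m-2}d$, and $\sup_u\bar\eta_{u,1}(s)=O(s^{-\beta})$ for some $\beta>2d$. Then $\sigma_n^{-1}S_n$ converges in distribution to $N(0,1)$ as $n\to\infty$. -/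

import Mathlib

open MeasureTheory ProbabilityTheory Filter Topology
open scoped ENNReal NNReal

noncomputable section

namespace WeakDep

/-- A countably infinite set of sites with a positive minimum distance between distinct sites. -/
structure IsLattice {E : Type*} [PseudoMetricSpace E] (D : Set E) : Prop where
  countable : D.Countable
  infinite : D.Infinite
  separated : ∃ ρ₀ : ℝ, 0 < ρ₀ ∧ ∀ i ∈ D, ∀ j ∈ D, i ≠ j → ρ₀ ≤ dist i j

/-- The Lipschitz constant of `f : ℝ^ι → ℝ` with respect to the `ℓ¹` distance, with value `∞`
when `f` is not Lipschitz. -/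
def lip {ι : Type*} [Fintype ι] (f : (ι → ℝ) → ℝ) : ℝ≥0∞ :=
  ⨆ (x : ι → ℝ) (y : ι → ℝ) (_ : x ≠ y), ENNReal.ofReal (|f x - f y| / ∑ k, |x k - y k|)

/-- The essential supremum `inf {C > 0 : P(|Z| ≤ C) = 1}` of `|Z|`, with value `∞` when `Z` is
not essentially bounded. -/
def supNorm {Ω : Type*} [MeasurableSpace Ω] (μ : Measure Ω) (Z : Ω → ℝ) : ℝ≥0∞ :=
  sInf {C : ℝ≥0∞ | ∀ᵐ ω ∂μ, ENNReal.ofReal |Z ω| ≤ C}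

section coefficients

variable {E : Type*} {Ω : Type*} [MeasurableSpace Ω]

/-- The random vector `(X i)_{i ∈ U}`. -/
def restr (X : E → Ω → ℝ) (U : Finset E) (ω : Ω) : U → ℝ := fun i => X i ω

/-- `θ`-dependence between `(X i)_{i ∈ U}` and `(X i)_{i ∈ V}`: the supremum of
`|Cov(f(X_U), g(X_V))| / (|V| ‖f‖_∞ Lip g)` over bounded measurable `f` and Lipschitz `g`.
Whenever the denominator vanishes so does the covariance, and the quotient `0 / 0` is `0`. -/
def thetaPair (μ : Measure Ω) (X : E → Ω → ℝ) (U V : Finset E) : ℝ≥0∞ :=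
  ⨆ (f : (U → ℝ) → ℝ) (g : (V → ℝ) → ℝ)
    (_ : Measurable f ∧ supNorm μ (fun ω => f (restr X U ω)) < ∞ ∧ lip g < ∞),
    ENNReal.ofReal |covariance (fun ω => f (restr X U ω)) (fun ω => g (restr X V ω)) μ| /
      ((V.card : ℝ≥0∞) * supNorm μ (fun ω => f (restr X U ω)) * lip g)

/-- `η`-dependence between `(X i)_{i ∈ U}` and `(X i)_{i ∈ V}`: the supremum of
`|Cov(f(X_U), g(X_V))| / (|U| ‖g‖_∞ Lip f + |V| ‖f‖_∞ Lip g)` over bounded Lipschitz `f`, `g`. -/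
def etaPair (μ : Measure Ω) (X : E → Ω → ℝ) (U V : Finset E) : ℝ≥0∞ :=
  ⨆ (f : (U → ℝ) → ℝ) (g : (V → ℝ) → ℝ)
    (_ : (supNorm μ (fun ω => f (restr X U ω)) < ∞ ∧ lip f < ∞) ∧
      (supNorm μ (fun ω => g (restr X V ω)) < ∞ ∧ lip g < ∞)),
    ENNReal.ofReal |covariance (fun ω => f (restr X U ω)) (fun ω => g (restr X V ω)) μ| /
      ((U.card : ℝ≥0∞) * supNorm μ (fun ω => g (restr X V ω)) * lip f +
        (V.card : ℝ≥0∞) * supNorm μ (fun ω => f (restr X U ω)) * lip g)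

end coefficients

section arrays

variable {E : Type*} [PseudoMetricSpace E] {Ω : ℕ → Type*} [∀ n, MeasurableSpace (Ω n)]

/-- The uniform coefficient `sup_n ε_{n,u,v}(s)`, where `ε_{n,u,v}(s)` is the supremum of
`pair n U V` over `U, V ⊆ D n` with `|U| = u`, `|V| = v` at distance at least `s`. -/
def unifCoeff (D : ℕ → Finset E) (pair : ℕ → Finset E → Finset E → ℝ≥0∞) (u v : ℕ) (s : ℝ) :
    ℝ≥0∞ :=
  ⨆ (n : ℕ) (U : Finset E) (V : Finset E)
    (_ : U ⊆ D n ∧ V ⊆ D n ∧ U.card = u ∧ V.card = v ∧ ∀ i ∈ U, ∀ j ∈ V, s ≤ dist i j),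
    pair n U V

/-- The coefficients `θ̄_{u,v}(s)` of the array `{X n i : i ∈ D n}`. -/
def thetaBar (μ : ∀ n, Measure (Ω n)) (D : ℕ → Finset E) (X : ∀ n, E → Ω n → ℝ) :
    ℕ → ℕ → ℝ → ℝ≥0∞ :=
  unifCoeff D (fun n => thetaPair (μ n) (X n))

/-- The coefficients `η̄_{u,v}(s)` of the array `{X n i : i ∈ D n}`. -/
def etaBar (μ : ∀ n, Measure (Ω n)) (D : ℕ → Finset E) (X : ∀ n, E → Ω n → ℝ) :
    ℕ → ℕ → ℝ → ℝ≥0∞ :=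
  unifCoeff D (fun n => etaPair (μ n) (X n))

end arrays

/-- `ε(s) = O(s^{-a})` as `s → ∞`. -/
def IsBigOPow (ε : ℝ → ℝ≥0∞) (a : ℝ) : Prop :=
  ∃ C : ℝ≥0, ∀ᶠ s : ℝ in atTop, ε s ≤ C * ENNReal.ofReal (s ^ (-a))

/-- Polynomial decay of a family `ε u v s` of dependence coefficients: `ε_{u,v}(s) = O(s^{-α})`
for all `u + v ≤ 4`, with `α > d (m-1)/(m-2)`, and `sup_u ε_{u,1}(s) = O(s^{-β})`, with
`β > b`. -/
def PolyDecay (ε : ℕ → ℕ → ℝ → ℝ≥0∞) (d : ℕ) (m b : ℝ) : Prop :=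
  (∃ α : ℝ, (m - 1) / (m - 2) * d < α ∧ ∀ u v : ℕ, u + v ≤ 4 → IsBigOPow (ε u v) α) ∧
  (∃ β : ℝ, b < β ∧ IsBigOPow (fun s => ⨆ u : ℕ, ε u 1 s) β)

/-- `M_n = sup_{i ∈ D_n} c_{i,n}` (a maximum, as `D_n` is finite). -/
def scale {E : Type*} (D : ℕ → Finset E) (c : ℕ → E → ℝ) (n : ℕ) : ℝ := ⨆ i : D n, c n i

/-- `S_n = ∑_{i ∈ D_n} X_{i,n}`. -/
def partialSum {E : Type*} {Ω : ℕ → Type*} (D : ℕ → Finset E) (X : ∀ n, E → Ω n → ℝ) (n : ℕ)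
    (ω : Ω n) : ℝ := ∑ i ∈ D n, X n i ω

end WeakDep

end

/-!
After dividing by `M_n` one may assume uniformly bounded `m`-th moments. Truncation at level `T`
splits each variable into a clipped part and a tail; interpolating between the covariance
inequality and the moment bound, the tails have summable covariances decaying at the rate
`α (m - 2) / (m - 1) > d`, so their sum is negligible compared with `σ_n` as `T → ∞`, uniformly in
`n`. For the clipped variables `Z_i` the central limit theorem follows by Stein's method in the form
of Bolthausen: let `S_i` be the sum of the `Z_j` with `dist i j ≤ |D_n| ^ γ` and `W = σ⁻¹ ∑ Z_i`.
The characteristic function `φ` of `W` satisfies `φ' + t φ ≈ 0`, with three errors: the covariances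
of `Z_i` with functions of the variables outside the neighbourhood of `i`, controlled by the
coefficients `ε_{u,1}`; the `L¹` deviation of `σ⁻² ∑ Z_i S_i` from `1`, controlled by its variance
and hence by `ε_{u,v}` with `u + v ≤ 4`; and a quadratic Taylor remainder. A Gronwall type argument
then gives `φ t ≈ exp (-t² / 2)`.
-/

noncomputable section

namespace WeakDep

/-- Uniform growth of order at most `d` of the finite sets `D n`: for every `b > d` the sums
`∑ⱼ (1 + dist i j)⁻ᵇ` over `j ∈ D n` are bounded uniformly in `n` and `i ∈ D n`. Only through
this condition does the geometry of `ℝᵈ` enter. -/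
def HasPolyGrowth {E : Type*} [PseudoMetricSpace E] (D : ℕ → Finset E) (d : ℝ) : Prop :=
  ∀ b, d < b → ∃ S : ℝ, ∀ n, ∀ i ∈ D n, ∑ j ∈ D n, (1 + dist i j) ^ (-b) ≤ S

theorem rpow_neg_one_add_dist_le {E : Type*} [PseudoMetricSpace E] {i j x : E} {ρ b : ℝ}
    (hb : 0 ≤ b) (hx : dist x j ≤ ρ) :
    (1 + dist i j) ^ (-b) ≤ (1 + ρ) ^ b * (1 + dist x i) ^ (-b) := by
  have hρ : 0 ≤ ρ := dist_nonneg.trans hx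
  have hle : 1 + dist x i ≤ (1 + ρ) * (1 + dist i j) := by
    have := dist_triangle x j i
    rw [dist_comm j i] at this
    nlinarith [dist_nonneg (x := i) (y := j)]
  have hpow : (1 + dist x i) ^ b ≤ (1 + ρ) ^ b * (1 + dist i j) ^ b := by
    rw [← Real.mul_rpow (by positivity) (by positivity)]
    exact Real.rpow_le_rpow (by positivity) hle hb
  rw [Real.rpow_neg (by positivity), Real.rpow_neg (by positivity), inv_eq_one_div,
    ← div_eq_mul_inv, div_le_div_iff₀ (by positivity) (by positivity), one_mul]
  exact hpow

section packing

variable {E : Type*} [NormedAddCommGroup E] [NormedSpace ℝ E] [FiniteDimensional ℝ E]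

theorem sum_rpow_neg_mul_measure_ball_le [MeasurableSpace E] [BorelSpace E] (ν : Measure E)
    [ν.IsAddHaarMeasure] {F : Finset E} {ρ b : ℝ} (hρ : 0 ≤ ρ)
    (hF : (F : Set E).Pairwise fun j k => 2 * ρ ≤ dist j k)
    (hb : (Module.finrank ℝ E : ℝ) < b) (i : E) :
    (∑ j ∈ F, (1 + dist i j) ^ (-b)) * ν.real (Metric.ball 0 ρ) ≤
      (1 + ρ) ^ b * ∫ x, (1 + ‖x‖) ^ (-b) ∂ν := by
  have hb₀ : 0 ≤ b := (Nat.cast_nonneg _).trans hb.le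
  have hint : Integrable (fun x : E => (1 + ‖x - i‖) ^ (-b)) ν :=
    (integrable_one_add_norm hb).comp_sub_right i
  have hdisj : (F : Set E).PairwiseDisjoint fun j => Metric.ball j ρ := fun j hj k hk hjk =>
    Metric.ball_disjoint_ball (by linarith [hF hj hk hjk])
  have hterm : ∀ j ∈ F, (1 + dist i j) ^ (-b) * ν.real (Metric.ball 0 ρ) ≤
      ∫ x in Metric.ball j ρ, (1 + ρ) ^ b * (1 + ‖x - i‖) ^ (-b) ∂ν := fun j _ => by
    calc (1 + dist i j) ^ (-b) * ν.real (Metric.ball 0 ρ)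
        = ∫ _ in Metric.ball j ρ, (1 + dist i j) ^ (-b) ∂ν := by
          rw [setIntegral_const, smul_eq_mul, mul_comm, measureReal_def, measureReal_def,
            Measure.addHaar_ball_center ν j]
      _ ≤ _ := setIntegral_mono_on (integrableOn_const measure_ball_lt_top.ne)
          (hint.const_mul _).integrableOn measurableSet_ball fun x hx => by
            rw [← dist_eq_norm]
            exact rpow_neg_one_add_dist_le hb₀ (Metric.mem_ball.1 hx).le
  calc (∑ j ∈ F, (1 + dist i j) ^ (-b)) * ν.real (Metric.ball 0 ρ)
      ≤ ∑ j ∈ F, ∫ x in Metric.ball j ρ, (1 + ρ) ^ b * (1 + ‖x - i‖) ^ (-b) ∂ν := by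
        rw [Finset.sum_mul]
        exact Finset.sum_le_sum hterm
    _ = ∫ x in ⋃ j ∈ F, Metric.ball j ρ, (1 + ρ) ^ b * (1 + ‖x - i‖) ^ (-b) ∂ν :=
        (integral_biUnion_finset F (fun _ _ => measurableSet_ball) hdisj
          fun _ _ => (hint.const_mul _).integrableOn).symm
    _ ≤ ∫ x, (1 + ρ) ^ b * (1 + ‖x - i‖) ^ (-b) ∂ν :=
        setIntegral_le_integral (hint.const_mul _) (.of_forall fun x => by positivity)
    _ = (1 + ρ) ^ b * ∫ x, (1 + ‖x‖) ^ (-b) ∂ν := by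
        rw [integral_const_mul, integral_sub_right_eq_self (fun x : E => (1 + ‖x‖) ^ (-b)) i]

theorem hasPolyGrowth_of_separated {L : Set E} {ρ₀ : ℝ} (hρ₀ : 0 < ρ₀)
    (hL : L.Pairwise fun i j => ρ₀ ≤ dist i j) {D : ℕ → Finset E}
    (hDL : ∀ n, (D n : Set E) ⊆ L) : HasPolyGrowth D (Module.finrank ℝ E) := fun b hb => by
  borelize E
  have hvol : 0 < (Measure.addHaar : Measure E).real (Metric.ball 0 (ρ₀ / 2)) :=
    ENNReal.toReal_pos (Metric.measure_ball_pos _ _ (half_pos hρ₀)).ne' measure_ball_lt_top.ne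
  refine ⟨_, fun n i _ => (le_div_iff₀ hvol).2 <|
    sum_rpow_neg_mul_measure_ball_le _ (half_pos hρ₀).le (fun j hj k hk hjk => ?_) hb i⟩
  linarith [hL (hDL n hj) (hDL n hk) hjk]

end packing

theorem card_filter_dist_le {E : Type*} [PseudoMetricSpace E] {F : Finset E} {i : E} {b S r : ℝ}
    (hb : 0 ≤ b) (hS : ∑ j ∈ F, (1 + dist i j) ^ (-b) ≤ S) (hr : 0 ≤ r) :
    ((F.filter fun j => dist i j ≤ r).card : ℝ) ≤ S * (1 + r) ^ b := by
  have hcard : ((F.filter fun j => dist i j ≤ r).card : ℝ) * (1 + r) ^ (-b) ≤ S := by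
    rw [← nsmul_eq_mul, ← Finset.sum_const]
    calc ∑ _j ∈ F.filter fun j => dist i j ≤ r, (1 + r) ^ (-b)
        ≤ ∑ j ∈ F with dist i j ≤ r, (1 + dist i j) ^ (-b) :=
          Finset.sum_le_sum fun j hj => Real.rpow_le_rpow_of_nonpos (by positivity)
            (by linarith [(Finset.mem_filter.1 hj).2]) (by linarith)
      _ ≤ ∑ j ∈ F, (1 + dist i j) ^ (-b) := Finset.sum_le_sum_of_subset_of_nonneg
          (Finset.filter_subset _ F) fun j _ _ => by positivity
      _ ≤ S := hS
  rwa [Real.rpow_neg (by positivity), ← div_eq_mul_inv, div_le_iff₀ (by positivity)] at hcard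

theorem sum_rpow_neg_filter_not_dist_le {E : Type*} [PseudoMetricSpace E] {F : Finset E} {i : E}
    {b a S r : ℝ} (hba : b ≤ a) (hS : ∑ j ∈ F, (1 + dist i j) ^ (-b) ≤ S) (hr : 0 ≤ r) :
    ∑ j ∈ F with ¬ dist i j ≤ r, (1 + dist i j) ^ (-a) ≤ (1 + r) ^ (-(a - b)) * S := by
  calc ∑ j ∈ F with ¬ dist i j ≤ r, (1 + dist i j) ^ (-a)
      ≤ ∑ j ∈ F with ¬ dist i j ≤ r, (1 + r) ^ (-(a - b)) * (1 + dist i j) ^ (-b) :=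
        Finset.sum_le_sum fun j hj => by
          have hlt : r ≤ dist i j := (not_le.1 (Finset.mem_filter.1 hj).2).le
          rw [show -a = -(a - b) + -b by ring, Real.rpow_add (by positivity)]
          gcongr ?_ * _
          exact Real.rpow_le_rpow_of_nonpos (by positivity) (by linarith) (by linarith)
    _ ≤ (1 + r) ^ (-(a - b)) * ∑ j ∈ F, (1 + dist i j) ^ (-b) := by
        rw [← Finset.mul_sum]
        gcongr
        exact Finset.filter_subset _ F
    _ ≤ (1 + r) ^ (-(a - b)) * S := by gcongr

theorem rpow_mul_le_add {x y p : ℝ} (hx : 0 ≤ x) (hy : 0 ≤ y) (hp : 0 < p) :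
    x ^ p * y ≤ x ^ (p + 1) + y ^ (p + 1) := by
  have key : ∀ z : ℝ, 0 ≤ z → z ^ p * z = z ^ (p + 1) := fun z hz =>
    (Real.rpow_add_one' hz (by linarith)).symm
  rcases le_total x y with h | h
  · calc x ^ p * y ≤ y ^ p * y := by gcongr
      _ = y ^ (p + 1) := key y hy
      _ ≤ _ := le_add_of_nonneg_left (by positivity)
  · calc x ^ p * y ≤ x ^ p * x := by gcongr
      _ = x ^ (p + 1) := key x hx
      _ ≤ _ := le_add_of_nonneg_right (by positivity)

theorem rpow_le_one_add_rpow {x p q : ℝ} (hx : 0 ≤ x) (hp : 0 ≤ p) (hpq : p ≤ q) :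
    x ^ p ≤ 1 + x ^ q := by
  rcases le_total x 1 with h | h
  · exact (Real.rpow_le_one hx h hp).trans (le_add_of_nonneg_right (by positivity))
  · exact (Real.rpow_le_rpow_of_exponent_le h hpq).trans (by linarith)

theorem le_mul_one_add_rpow_neg {c C₀ C₁ s₀ s a : ℝ} (hs₀ : 1 ≤ s₀) (hs : 0 ≤ s) (ha : 0 ≤ a)
    (hC₀ : 0 ≤ C₀) (hC₁ : 0 ≤ C₁) (h₀ : c ≤ C₀) (h₁ : s₀ ≤ s → c ≤ C₁ * s ^ (-a)) :
    c ≤ (C₀ * (1 + s₀) ^ a + C₁ * 2 ^ a) * (1 + s) ^ (-a) := by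
  rw [Real.rpow_neg (by positivity), ← div_eq_mul_inv, le_div_iff₀ (by positivity)]
  rcases le_or_gt s₀ s with h | h
  · have hs' : 0 < s := by linarith
    have hpow : (1 + s) ^ a ≤ 2 ^ a * s ^ a := by
      rw [← Real.mul_rpow (by norm_num) hs]
      exact Real.rpow_le_rpow (by positivity) (by linarith) ha
    calc c * (1 + s) ^ a ≤ C₁ * s ^ (-a) * (1 + s) ^ a := by gcongr; exact h₁ h
      _ ≤ C₁ * s ^ (-a) * (2 ^ a * s ^ a) := by gcongr
      _ = C₁ * 2 ^ a := by rw [Real.rpow_neg hs]; field_simp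
      _ ≤ _ := le_add_of_nonneg_left (by positivity)
  · calc c * (1 + s) ^ a ≤ C₀ * (1 + s₀) ^ a := by gcongr
      _ ≤ _ := le_add_of_nonneg_right (by positivity)

theorem le_rpow_mul_rpow_of_le {c x y θ : ℝ} (hc : 0 ≤ c) (hx : c ≤ x) (hy : c ≤ y)
    (hθ₀ : 0 ≤ θ) (hθ₁ : θ ≤ 1) : c ≤ x ^ θ * y ^ (1 - θ) := by
  calc c = c ^ θ * c ^ (1 - θ) := by
        rw [← Real.rpow_add_of_nonneg hc hθ₀ (by linarith)]; simp
    _ ≤ _ := mul_le_mul (Real.rpow_le_rpow hc hx hθ₀) (Real.rpow_le_rpow hc hy (by linarith))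
        (Real.rpow_nonneg hc _) (Real.rpow_nonneg (hc.trans hx) _)

theorem abs_sub_le_of_lipschitzWith_one {h : ℝ → ℝ} (hh : LipschitzWith 1 h) (x y : ℝ) :
    |h x - h y| ≤ |x - y| := by
  simpa [Real.dist_eq] using hh.dist_le_mul x y

/-- The truncation of the real number `y` to the interval `[-T, T]`. -/
def clip (T y : ℝ) : ℝ := max (-T) (min T y)

theorem abs_clip_le {T : ℝ} (hT : 0 ≤ T) (y : ℝ) : |clip T y| ≤ T :=
  abs_le.2 ⟨le_max_left _ _, max_le (by linarith) (min_le_left _ _)⟩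

theorem clip_eq_self {T y : ℝ} (h : |y| ≤ T) : clip T y = y := by
  rw [abs_le] at h
  rw [clip, min_eq_right h.2, max_eq_right h.1]

theorem clip_zero {T : ℝ} (hT : 0 ≤ T) : clip T 0 = 0 := clip_eq_self (by simpa using hT)

theorem lipschitzWith_clip (T : ℝ) : LipschitzWith 1 (clip T) :=
  (LipschitzWith.id.const_min T).const_max (-T)

theorem lipschitzWith_sub_clip (T : ℝ) : LipschitzWith 1 fun y => y - clip T y := by
  refine .of_dist_le_mul fun x y => ?_
  simp only [Real.dist_eq, NNReal.coe_one, one_mul, clip]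
  grind

/-- A normal contraction of the real line: a `1`-Lipschitz function vanishing at the origin. -/
structure IsNormalContraction (h : ℝ → ℝ) : Prop where
  map_zero : h 0 = 0
  lipschitz : LipschitzWith 1 h

namespace IsNormalContraction

variable {h h' : ℝ → ℝ} {T : ℝ}

theorem abs_le (hh : IsNormalContraction h) (y : ℝ) : |h y| ≤ |y| := by
  simpa [hh.map_zero] using abs_sub_le_of_lipschitzWith_one hh.lipschitz y 0

theorem comp (hh : IsNormalContraction h) (hh' : IsNormalContraction h') :
    IsNormalContraction (h ∘ h') :=
  ⟨by simp [hh'.map_zero, hh.map_zero], by simpa using hh.lipschitz.comp hh'.lipschitz⟩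

protected theorem id : IsNormalContraction fun y => y := ⟨rfl, LipschitzWith.id⟩

protected theorem clip (hT : 0 ≤ T) : IsNormalContraction (clip T) :=
  ⟨clip_zero hT, lipschitzWith_clip T⟩

theorem sub_clip (hT : 0 ≤ T) : IsNormalContraction fun y => y - WeakDep.clip T y :=
  ⟨by simp [clip_zero hT], lipschitzWith_sub_clip T⟩

end IsNormalContraction

theorem abs_sub_clip_le_rpow {T m : ℝ} (hT : 0 < T) (hm : 2 ≤ m) (y : ℝ) :
    |y - clip T y| ≤ T ^ (-(m - 2)) * |y| ^ (m - 1) := by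
  rcases le_or_gt |y| T with h | h
  · rw [clip_eq_self h, sub_self, abs_zero]
    positivity
  · have hy : 0 < |y| := hT.trans h
    rw [Real.rpow_neg hT.le, ← div_eq_inv_mul, le_div_iff₀ (by positivity)]
    calc |y - clip T y| * T ^ (m - 2) ≤ |y| * |y| ^ (m - 2) :=
          mul_le_mul ((IsNormalContraction.sub_clip hT.le).abs_le y)
            (Real.rpow_le_rpow hT.le h.le (by linarith)) (by positivity) (by positivity)
      _ = |y| ^ (m - 1) := by
        rw [show m - 1 = 1 + (m - 2) by ring, Real.rpow_add hy, Real.rpow_one]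

/-- `f` is bounded by `A` and `L`-Lipschitz for the `ℓ¹` distance. This replaces the extended real
valued `supNorm` and `lip` of the dependence coefficients by real bounds. -/
structure BddLip {ι : Type*} [Fintype ι] (f : (ι → ℝ) → ℝ) (A L : ℝ) : Prop where
  abs_le : ∀ x, |f x| ≤ A
  lip_nonneg : 0 ≤ L
  abs_sub_le : ∀ x y, |f x - f y| ≤ L * ∑ k, |x k - y k|

namespace BddLip

variable {ι : Type*} [Fintype ι] {f g : (ι → ℝ) → ℝ} {A A' L L' : ℝ}

theorem nonneg (hf : BddLip f A L) : 0 ≤ A := (abs_nonneg _).trans (hf.abs_le 0)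

theorem mul (hf : BddLip f A L) (hg : BddLip g A' L') :
    BddLip (fun x => f x * g x) (A * A') (A * L' + A' * L) where
  abs_le x := by
    rw [abs_mul]
    exact mul_le_mul (hf.abs_le x) (hg.abs_le x) (abs_nonneg _) hf.nonneg
  lip_nonneg := add_nonneg (mul_nonneg hf.nonneg hg.lip_nonneg) (mul_nonneg hg.nonneg hf.lip_nonneg)
  abs_sub_le x y := by
    calc |f x * g x - f y * g y| = |f x * (g x - g y) + (f x - f y) * g y| := by ring_nf
      _ ≤ |f x| * |g x - g y| + |f x - f y| * |g y| := by
          rw [← abs_mul, ← abs_mul]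
          exact abs_add_le _ _
      _ ≤ A * (L' * ∑ k, |x k - y k|) + L * (∑ k, |x k - y k|) * A' := by
          have hA := hf.nonneg
          have hL := hf.lip_nonneg
          gcongr
          exacts [hf.abs_le x, hg.abs_sub_le x y, hf.abs_sub_le x y, hg.abs_le y]
      _ = _ := by ring

theorem continuous (hf : BddLip f A L) : Continuous f := by
  refine continuous_iff_continuousAt.2 fun x => tendsto_iff_dist_tendsto_zero.2 ?_
  have hsum : Continuous fun y : ι → ℝ => L * ∑ k, |y k - x k| := by fun_prop
  exact squeeze_zero (fun _ => dist_nonneg) (fun y => hf.abs_sub_le y x)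
    (by simpa using hsum.tendsto x)

theorem comp_eval {q : ℝ → ℝ} {B : ℝ} (hB : ∀ y, |q y| ≤ B) (hq : LipschitzWith 1 q) (k : ι) :
    BddLip (fun x : ι → ℝ => q (x k)) B 1 where
  abs_le x := hB _
  lip_nonneg := zero_le_one
  abs_sub_le x y := by
    rw [one_mul]
    exact (abs_sub_le_of_lipschitzWith_one hq _ _).trans
      (Finset.single_le_sum (f := fun k => |x k - y k|) (fun _ _ => abs_nonneg _)
        (Finset.mem_univ k))

theorem comp_mul (hf : BddLip f A L) {r : ℝ} (hr : 0 ≤ r) :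
    BddLip (fun x => f fun k => r * x k) A (L * r) where
  abs_le x := hf.abs_le _
  lip_nonneg := mul_nonneg hf.lip_nonneg hr
  abs_sub_le x y := by
    refine (hf.abs_sub_le _ _).trans (le_of_eq ?_)
    simp_rw [← mul_sub, abs_mul, abs_of_nonneg hr, ← Finset.mul_sum]
    ring

end BddLip

section moments

variable {Ω : Type*} [MeasurableSpace Ω] {μ : Measure Ω} [IsProbabilityMeasure μ]

theorem integral_le_of_forall_le {F : Ω → ℝ} {c : ℝ} (hF : Integrable F μ) (hc : ∀ ω, F ω ≤ c) :
    ∫ ω, F ω ∂μ ≤ c := by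
  simpa using integral_mono hF (integrable_const _) hc

theorem abs_covariance_le {P Q : Ω → ℝ} (hP : MemLp P 2 μ) (hQ : MemLp Q 2 μ) :
    |cov[P, Q; μ]| ≤ ∫ ω, |P ω| * |Q ω| ∂μ + (∫ ω, |P ω| ∂μ) * ∫ ω, |Q ω| ∂μ := by
  have hprod : |∫ ω, (P * Q) ω ∂μ| ≤ ∫ ω, |P ω| * |Q ω| ∂μ := by
    simpa only [Pi.mul_apply, abs_mul] using abs_integral_le_integral_abs (f := P * Q) (μ := μ)
  rw [covariance_eq_sub hP hQ]
  refine (abs_sub _ _).trans (add_le_add hprod ?_)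
  rw [abs_mul]
  gcongr <;> exact abs_integral_le_integral_abs

theorem abs_covariance_le_of_abs_le {P Q : Ω → ℝ} {A A' : ℝ} (hP : Measurable P)
    (hQ : Measurable Q) (hA : ∀ ω, |P ω| ≤ A) (hA' : ∀ ω, |Q ω| ≤ A') :
    |cov[P, Q; μ]| ≤ 2 * (A * A') := by
  obtain ⟨ω₀⟩ : Nonempty Ω := nonempty_of_isProbabilityMeasure μ
  have hA₀ : 0 ≤ A := (abs_nonneg _).trans (hA ω₀)
  have hP₂ : MemLp P 2 μ := .of_bound hP.aestronglyMeasurable A (.of_forall hA)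
  have hQ₂ : MemLp Q 2 μ := .of_bound hQ.aestronglyMeasurable A' (.of_forall hA')
  have hPQ : ∫ ω, |P ω| * |Q ω| ∂μ ≤ A * A' :=
    integral_le_of_forall_le (by simpa [abs_mul] using (hP₂.integrable_mul hQ₂).abs) fun ω =>
      mul_le_mul (hA ω) (hA' ω) (abs_nonneg _) hA₀
  have : 0 ≤ ∫ ω, |Q ω| ∂μ := integral_nonneg fun _ => abs_nonneg _
  calc |cov[P, Q; μ]| ≤ _ := abs_covariance_le hP₂ hQ₂
    _ ≤ A * A' + A * A' := by
        gcongr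
        exacts [integral_le_of_forall_le (hP₂.integrable (by simp)).abs hA,
          integral_le_of_forall_le (hQ₂.integrable (by simp)).abs hA']
    _ = _ := by ring

theorem memLp_two_of_integrable_rpow {Y : Ω → ℝ} {m : ℝ} (hm : 2 ≤ m) (hY : Measurable Y)
    (hint : Integrable (fun ω => |Y ω| ^ m) μ) : MemLp Y 2 μ := by
  rw [memLp_two_iff_integrable_sq hY.aestronglyMeasurable]
  refine ((integrable_const 1).add hint).mono' (by fun_prop) (.of_forall fun ω => ?_)
  rw [Real.norm_eq_abs, abs_pow, ← Real.rpow_natCast]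
  exact rpow_le_one_add_rpow (abs_nonneg _) (by norm_num) (by exact_mod_cast hm)

theorem integral_le_one_add_of_le_rpow {Y P : Ω → ℝ} {m K p u : ℝ}
    (hint : Integrable (fun ω => |Y ω| ^ m) μ) (hK : ∫ ω, |Y ω| ^ m ∂μ ≤ K)
    (hP : Integrable P μ) (hu : 0 ≤ u) (hp : 0 ≤ p) (hpm : p ≤ m)
    (hPY : ∀ ω, P ω ≤ u * |Y ω| ^ p) : ∫ ω, P ω ∂μ ≤ u * (1 + K) := by
  calc ∫ ω, P ω ∂μ ≤ ∫ ω, u * (1 + |Y ω| ^ m) ∂μ := by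
        refine integral_mono hP (((integrable_const 1).add hint).const_mul u) fun ω => ?_
        exact (hPY ω).trans <|
          mul_le_mul_of_nonneg_left (rpow_le_one_add_rpow (abs_nonneg _) hp hpm) hu
    _ = u * (1 + ∫ ω, |Y ω| ^ m ∂μ) := by
        rw [integral_const_mul, integral_add (integrable_const 1) hint]
        simp
    _ ≤ u * (1 + K) := by gcongr

theorem integral_abs_mul_abs_le_of_moment {Y Y' P Q : Ω → ℝ} {m K p u : ℝ}
    (hint : Integrable (fun ω => |Y ω| ^ m) μ) (hK : ∫ ω, |Y ω| ^ m ∂μ ≤ K)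
    (hint' : Integrable (fun ω => |Y' ω| ^ m) μ) (hK' : ∫ ω, |Y' ω| ^ m ∂μ ≤ K)
    (hP : MemLp P 2 μ) (hQ : MemLp Q 2 μ) (hu : 0 ≤ u) (hp : 0 < p) (hpm : p + 1 ≤ m)
    (hPY : ∀ ω, |P ω| ≤ u * |Y ω| ^ p) (hQY : ∀ ω, |Q ω| ≤ |Y' ω|) :
    ∫ ω, |P ω| * |Q ω| ∂μ ≤ u * (2 + 2 * K) := by
  have hmono : ∀ y : ℝ, |y| ^ (p + 1) ≤ 1 + |y| ^ m := fun y =>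
    rpow_le_one_add_rpow (abs_nonneg y) (by linarith) hpm
  have hpoint : ∀ ω, |P ω| * |Q ω| ≤ u * ((1 + |Y ω| ^ m) + (1 + |Y' ω| ^ m)) := fun ω => by
    calc |P ω| * |Q ω| ≤ u * |Y ω| ^ p * |Y' ω| :=
          mul_le_mul (hPY ω) (hQY ω) (abs_nonneg _) (by positivity)
      _ ≤ u * (|Y ω| ^ (p + 1) + |Y' ω| ^ (p + 1)) := by
          rw [mul_assoc]
          gcongr
          exact rpow_mul_le_add (abs_nonneg _) (abs_nonneg _) hp
      _ ≤ _ := by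
          gcongr
          exacts [hmono _, hmono _]
  have hY : Integrable (fun ω => 1 + |Y ω| ^ m) μ := (integrable_const 1).add hint
  have hY' : Integrable (fun ω => 1 + |Y' ω| ^ m) μ := (integrable_const 1).add hint'
  calc ∫ ω, |P ω| * |Q ω| ∂μ ≤ ∫ ω, u * ((1 + |Y ω| ^ m) + (1 + |Y' ω| ^ m)) ∂μ :=
        integral_mono (by simpa [abs_mul] using (hP.integrable_mul hQ).abs)
          ((hY.add hY').const_mul u) hpoint
    _ = u * ((1 + ∫ ω, |Y ω| ^ m ∂μ) + (1 + ∫ ω, |Y' ω| ^ m ∂μ)) := by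
        rw [integral_const_mul, integral_add hY hY', integral_add (integrable_const 1) hint,
          integral_add (integrable_const 1) hint']
        simp
    _ ≤ u * (2 + 2 * K) := mul_le_mul_of_nonneg_left (by linarith) hu

theorem abs_covariance_le_of_moment {Y Y' P Q : Ω → ℝ} {m K p u : ℝ}
    (hint : Integrable (fun ω => |Y ω| ^ m) μ) (hK : ∫ ω, |Y ω| ^ m ∂μ ≤ K)
    (hint' : Integrable (fun ω => |Y' ω| ^ m) μ) (hK' : ∫ ω, |Y' ω| ^ m ∂μ ≤ K)
    (hP : MemLp P 2 μ) (hQ : MemLp Q 2 μ) (hu : 0 ≤ u) (hp : 0 < p) (hpm : p + 1 ≤ m)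
    (hPY : ∀ ω, |P ω| ≤ u * |Y ω| ^ p) (hQY : ∀ ω, |Q ω| ≤ |Y' ω|) :
    |cov[P, Q; μ]| ≤ u * ((1 + K) * (3 + K)) := by
  have hK₀ : 0 ≤ K := (integral_nonneg fun ω => by positivity).trans hK
  have : 0 ≤ ∫ ω, |Q ω| ∂μ := integral_nonneg fun _ => abs_nonneg _
  calc |cov[P, Q; μ]| ≤ _ := abs_covariance_le hP hQ
    _ ≤ u * (2 + 2 * K) + u * (1 + K) * (1 * (1 + K)) := by
        gcongr
        exacts [integral_abs_mul_abs_le_of_moment hint hK hint' hK' hP hQ hu hp hpm hPY hQY,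
          integral_le_one_add_of_le_rpow hint hK (hP.integrable (by simp)).abs hu hp.le
            (by linarith) hPY,
          integral_le_one_add_of_le_rpow (p := 1) hint' hK' (hQ.integrable (by simp)).abs
            zero_le_one zero_le_one (by linarith) (by simpa using hQY)]
    _ = u * ((1 + K) * (3 + K)) := by ring

end moments

/-- The constants governing a weakly dependent array: the order `m` and the size `K` of the moments,
and the exponent `α`, the size `κ` and the onset `s₀` of the decay of the covariances. -/
structure ArrayParams where
  (m K α κ s₀ : ℝ)
  two_lt_m : 2 < m
  K_nonneg : 0 ≤ K
  α_nonneg : 0 ≤ α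
  κ_nonneg : 0 ≤ κ
  one_le_s₀ : 1 ≤ s₀

namespace ArrayParams

variable (p : ArrayParams)

/-- The exponent of decay of the covariances of the variables themselves, smaller than `α` because
the variables are only bounded in `Lᵐ`. -/
def rate : ℝ := p.α * (p.m - 2) / (p.m - 1)

/-- A bound for the covariances obtained from the moments alone. -/
def momentConst : ℝ := (1 + p.K) * (3 + p.K)

/-- The constant in the bound `covConst * (1 + dist i j) ^ (-rate)` for the covariances. -/
def covConst : ℝ :=
  p.momentConst * (1 + p.s₀) ^ p.rate + 2 * (p.κ + p.momentConst) * 2 ^ p.rate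

/-- The constant in the bound `tailConst b T * (1 + dist i j) ^ (-b)` for the covariances of the
tails `Y i - clip T (Y i)`, for any `b < rate`; it tends to `0` as `T → ∞`. -/
def tailConst (b T : ℝ) : ℝ :=
  p.covConst ^ (b / p.rate) * (T ^ (-(p.m - 2)) * p.momentConst) ^ (1 - b / p.rate)

theorem rate_nonneg : 0 ≤ p.rate := by
  have := p.two_lt_m
  exact div_nonneg (mul_nonneg p.α_nonneg (by linarith)) (by linarith)

theorem momentConst_nonneg : 0 ≤ p.momentConst := by
  have := p.K_nonneg
  unfold momentConst
  positivity

theorem covConst_nonneg : 0 ≤ p.covConst := by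
  have := p.momentConst_nonneg
  have := p.κ_nonneg
  have := p.one_le_s₀
  unfold covConst
  positivity

theorem tailConst_nonneg (b : ℝ) {T : ℝ} (hT : 0 ≤ T) : 0 ≤ p.tailConst b T :=
  mul_nonneg (Real.rpow_nonneg p.covConst_nonneg _)
    (Real.rpow_nonneg (mul_nonneg (Real.rpow_nonneg hT _) p.momentConst_nonneg) _)

theorem tendsto_tailConst {b : ℝ} (hb : b < p.rate) :
    Tendsto (p.tailConst b) atTop (𝓝 0) := by
  have hθ : 0 < 1 - b / p.rate := by
    rcases p.rate_nonneg.eq_or_lt with h | h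
    · simp [← h]
    · linarith [(div_lt_one h).2 hb]
  have hpow : Tendsto (fun T : ℝ => T ^ (-(p.m - 2)) * p.momentConst) atTop (𝓝 0) := by
    simpa using (tendsto_rpow_neg_atTop (sub_pos.2 p.two_lt_m)).mul_const p.momentConst
  have hprod := (hpow.rpow_const (Or.inr hθ.le)).const_mul (p.covConst ^ (b / p.rate))
  rwa [Real.zero_rpow hθ.ne', mul_zero] at hprod

end ArrayParams

/-- A finite family of centred random variables with bounded `m`-th moments, in which the
covariances between bounded Lipschitz functions of at most four variables decay like `s ^ (-α)`. -/
structure WeakArray {E Ω : Type*} [PseudoMetricSpace E] [MeasurableSpace Ω] (p : ArrayParams)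
    (μ : Measure Ω) (Y : E → Ω → ℝ) (D : Finset E) : Prop where
  measurable : ∀ i ∈ D, Measurable (Y i)
  mean : ∀ i ∈ D, ∫ ω, Y i ω ∂μ = 0
  integrable_rpow : ∀ i ∈ D, Integrable (fun ω => |Y i ω| ^ p.m) μ
  moment_le : ∀ i ∈ D, ∫ ω, |Y i ω| ^ p.m ∂μ ≤ p.K
  cov_le : ∀ U V : Finset E, U ⊆ D → V ⊆ D → U.card + V.card ≤ 4 → ∀ s : ℝ, p.s₀ ≤ s →
    (∀ i ∈ U, ∀ j ∈ V, s ≤ dist i j) → ∀ (f : (U → ℝ) → ℝ) (g : (V → ℝ) → ℝ) (A A' L L' : ℝ),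
    BddLip f A L → BddLip g A' L' →
    |cov[fun ω => f (restr Y U ω), fun ω => g (restr Y V ω); μ]| ≤
      p.κ * s ^ (-p.α) * (A * L' + A' * L)

namespace WeakArray

variable {E Ω : Type*} [PseudoMetricSpace E] [MeasurableSpace Ω] {p : ArrayParams}
  {μ : Measure Ω} {Y : E → Ω → ℝ} {D : Finset E} {i j : E}
  {h h' : ℝ → ℝ} {T : ℝ}

theorem abs_cov_comp_clip_le (hY : WeakArray p μ Y D) (hi : i ∈ D) (hj : j ∈ D)
    (hs : p.s₀ ≤ dist i j) (hT : 0 ≤ T) (hh : IsNormalContraction h)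
    (hh' : IsNormalContraction h') :
    |cov[fun ω => h (clip T (Y i ω)), fun ω => h' (clip T (Y j ω)); μ]| ≤
      p.κ * dist i j ^ (-p.α) * (2 * T) := by
  have hlip : ∀ {q : ℝ → ℝ} (k : E), IsNormalContraction q →
      BddLip (fun x : ({k} : Finset E) → ℝ =>
        q (clip T (x ⟨k, Finset.mem_singleton_self k⟩))) T 1 :=
    fun k hq => .comp_eval (q := fun y => _) (fun y => (hq.abs_le _).trans (abs_clip_le hT y))
      (hq.comp (.clip hT)).lipschitz _
  refine (hY.cov_le {i} {j} (by simpa using hi) (by simpa using hj) (by simp) (dist i j) hs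
    (by simp) _ _ T T 1 1 (hlip i hh) (hlip j hh')).trans (le_of_eq ?_)
  ring

variable [IsProbabilityMeasure μ]

theorem memLp_comp (hY : WeakArray p μ Y D) (hi : i ∈ D) (hh : IsNormalContraction h) :
    MemLp (fun ω => h (Y i ω)) 2 μ :=
  (memLp_two_of_integrable_rpow p.two_lt_m.le (hY.measurable i hi) (hY.integrable_rpow i hi)).mono
    (hh.lipschitz.continuous.measurable.comp (hY.measurable i hi)).aestronglyMeasurable
    (.of_forall fun _ => hh.abs_le _)

theorem memLp (hY : WeakArray p μ Y D) (hi : i ∈ D) : MemLp (Y i) 2 μ :=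
  hY.memLp_comp hi .id

theorem abs_cov_le_momentConst (hY : WeakArray p μ Y D) (hi : i ∈ D) (hj : j ∈ D)
    (hh : IsNormalContraction h) (hh' : IsNormalContraction h') :
    |cov[fun ω => h (Y i ω), fun ω => h' (Y j ω); μ]| ≤ p.momentConst := by
  have := p.two_lt_m
  simpa [ArrayParams.momentConst] using
    abs_covariance_le_of_moment (u := 1) (p := 1) (hY.integrable_rpow i hi) (hY.moment_le i hi)
      (hY.integrable_rpow j hj) (hY.moment_le j hj) (hY.memLp_comp hi hh) (hY.memLp_comp hj hh')
      zero_le_one one_pos (by linarith) (by simpa using fun ω => hh.abs_le (Y i ω))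
      fun ω => hh'.abs_le _

theorem abs_cov_le_of_abs_le_tail (hY : WeakArray p μ Y D) (hi : i ∈ D) (hj : j ∈ D) (hT : 0 < T)
    {P : Ω → ℝ} (hP : MemLp P 2 μ) (hPY : ∀ ω, |P ω| ≤ |Y i ω - clip T (Y i ω)|)
    (hh' : IsNormalContraction h') :
    |cov[P, fun ω => h' (Y j ω); μ]| ≤ T ^ (-(p.m - 2)) * p.momentConst := by
  have := p.two_lt_m
  exact abs_covariance_le_of_moment (p := p.m - 1) (hY.integrable_rpow i hi) (hY.moment_le i hi)
    (hY.integrable_rpow j hj) (hY.moment_le j hj) hP (hY.memLp_comp hj hh') (by positivity)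
    (by linarith) (by linarith) (fun ω => (hPY ω).trans (abs_sub_clip_le_rpow hT (by linarith) _))
    fun ω => hh'.abs_le _

theorem abs_cov_le_of_clip (hY : WeakArray p μ Y D) (hi : i ∈ D) (hj : j ∈ D)
    (hs : p.s₀ ≤ dist i j) (hT : 0 < T) (hh : IsNormalContraction h)
    (hh' : IsNormalContraction h') :
    |cov[fun ω => h (Y i ω), fun ω => h' (Y j ω); μ]| ≤
      p.κ * dist i j ^ (-p.α) * (2 * T) + 2 * (T ^ (-(p.m - 2)) * p.momentConst) := by
  have hhc := hh.comp (.clip hT.le)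
  have hhc' := hh'.comp (.clip hT.le)
  set P := fun ω => h (Y i ω)
  set Q := fun ω => h' (Y j ω)
  set P' := fun ω => h (clip T (Y i ω))
  set Q' := fun ω => h' (clip T (Y j ω))
  have hP : MemLp P 2 μ := hY.memLp_comp hi hh
  have hQ : MemLp Q 2 μ := hY.memLp_comp hj hh'
  have hP' : MemLp P' 2 μ := hY.memLp_comp hi hhc
  have hQ' : MemLp Q' 2 μ := hY.memLp_comp hj hhc'
  have hsplit : cov[P, Q; μ] = cov[P', Q'; μ] + cov[P - P', Q; μ] + cov[Q - Q', P'; μ] := by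
    rw [covariance_sub_left hP hP' hQ, covariance_sub_left hQ hQ' hP', covariance_comm Q P',
      covariance_comm Q' P']
    ring
  have hclip : |cov[P', Q'; μ]| ≤ _ := hY.abs_cov_comp_clip_le hi hj hs hT.le hh hh'
  have htail : |cov[P - P', Q; μ]| ≤ _ := hY.abs_cov_le_of_abs_le_tail hi hj hT (hP.sub hP')
    (fun _ => abs_sub_le_of_lipschitzWith_one hh.lipschitz _ _) hh'
  have htail' : |cov[Q - Q', P'; μ]| ≤ _ := hY.abs_cov_le_of_abs_le_tail hj hi hT (hQ.sub hQ')
    (fun _ => abs_sub_le_of_lipschitzWith_one hh'.lipschitz _ _) hhc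
  rw [hsplit]
  refine (abs_add_three _ _ _).trans ?_
  linarith

theorem abs_cov_le (hY : WeakArray p μ Y D) (hi : i ∈ D) (hj : j ∈ D)
    (hh : IsNormalContraction h) (hh' : IsNormalContraction h') :
    |cov[fun ω => h (Y i ω), fun ω => h' (Y j ω); μ]| ≤
      p.covConst * (1 + dist i j) ^ (-p.rate) := by
  have hM := p.momentConst_nonneg
  have hκ := p.κ_nonneg
  have hm := p.two_lt_m
  refine le_mul_one_add_rpow_neg p.one_le_s₀ dist_nonneg p.rate_nonneg hM (by positivity)
    (hY.abs_cov_le_momentConst hi hj hh hh') fun hs => ?_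
  have hpos : 0 < dist i j := by linarith [p.one_le_s₀]
  -- The level `T = s ^ (α / (m - 1))` balances `s ^ (-α) * T` and `T ^ (-(m - 2))`.
  refine (hY.abs_cov_le_of_clip hi hj hs (T := dist i j ^ (p.α / (p.m - 1))) (by positivity)
    hh hh').trans (le_of_eq ?_)
  have htail : (dist i j ^ (p.α / (p.m - 1))) ^ (-(p.m - 2)) = dist i j ^ (-p.rate) := by
    rw [← Real.rpow_mul hpos.le, ArrayParams.rate]
    ring_nf
  have hmain : dist i j ^ (-p.α) * dist i j ^ (p.α / (p.m - 1)) = dist i j ^ (-p.rate) := by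
    rw [← Real.rpow_add hpos, ArrayParams.rate]
    congr 1
    field_simp [show p.m - 1 ≠ 0 by linarith]
    ring
  rw [htail, ← hmain]
  ring

theorem abs_cov_sub_clip_le (hY : WeakArray p μ Y D) (hi : i ∈ D) (hj : j ∈ D) (hT : 0 < T)
    (hh' : IsNormalContraction h') {b : ℝ} (hb : 0 ≤ b) (hb' : b < p.rate) :
    |cov[fun ω => Y i ω - clip T (Y i ω), fun ω => h' (Y j ω); μ]| ≤
      p.tailConst b T * (1 + dist i j) ^ (-b) := by
  have hrate : 0 < p.rate := hb.trans_lt hb'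
  have hclip : IsNormalContraction fun y => y - clip T y := .sub_clip hT.le
  -- Interpolation between a bound that decays with the distance and one that is small in `T`.
  refine (le_rpow_mul_rpow_of_le (θ := b / p.rate) (abs_nonneg _)
    (hY.abs_cov_le hi hj hclip hh')
    (hY.abs_cov_le_of_abs_le_tail hi hj hT (hY.memLp_comp hi hclip) (fun _ => le_rfl) hh')
    (by positivity) ((div_le_one hrate).2 hb'.le)).trans (le_of_eq ?_)
  rw [Real.mul_rpow p.covConst_nonneg (by positivity), ← Real.rpow_mul (by positivity),
    show -p.rate * (b / p.rate) = -b by field_simp, ArrayParams.tailConst]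
  ring

end WeakArray

theorem one_add_min_rpow_neg_le {x y a : ℝ} (hx : 0 ≤ x) (hy : 0 ≤ y) :
    (1 + min x y) ^ (-a) ≤ (1 + x) ^ (-a) + (1 + y) ^ (-a) := by
  rcases min_choice x y with h | h <;> rw [h]
  · exact le_add_of_nonneg_right (by positivity)
  · exact le_add_of_nonneg_left (by positivity)

theorem one_add_div_rpow_neg_le {x c a : ℝ} (hx : 0 ≤ x) (hc : 1 ≤ c) (ha : 0 ≤ a) :
    (1 + x / c) ^ (-a) ≤ c ^ a * (1 + x) ^ (-a) := by
  have hc₀ : 0 < c := by linarith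
  rw [Real.rpow_neg (by positivity), Real.rpow_neg (by positivity), ← div_eq_mul_inv,
    le_div_iff₀ (by positivity), ← div_eq_inv_mul, div_le_iff₀ (by positivity),
    ← Real.mul_rpow (by positivity) (by positivity)]
  refine Real.rpow_le_rpow (by positivity) ?_ ha
  rw [mul_add, mul_div_cancel₀ _ hc₀.ne']
  linarith

section counting

variable {ι : Type*} [DecidableEq ι] {D : Finset ι} {N M : ι → Finset ι} {ψ : ι → ι → ℝ} {S G : ℝ}

theorem sum_sum_pair_le (hψ : ∀ i j, 0 ≤ ψ i j) (hS : ∀ i ∈ D, ∑ j ∈ D, ψ i j ≤ S)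
    (hND : ∀ i ∈ D, N i ⊆ D) (hN : ∀ i ∈ D, ((N i).card : ℝ) ≤ G) {i : ι} (hi : i ∈ D)
    (hMD : M i ⊆ D) (hM : ((M i).card : ℝ) ≤ G) (j : ι) :
    ∑ k ∈ D, ∑ l ∈ N k, (ψ i k + if k ∈ M i then ψ i j + ψ i l else 0) ≤
      G * (2 * S + G * ψ i j) := by
  have hG : 0 ≤ G := (Nat.cast_nonneg _).trans hM
  have hS₀ : 0 ≤ S := (Finset.sum_nonneg fun j _ => hψ i j).trans (hS i hi)
  have hrow : ∀ k ∈ M i, ∑ l ∈ N k, (ψ i j + ψ i l) ≤ G * ψ i j + S := fun k hk => by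
    rw [Finset.sum_add_distrib, Finset.sum_const, nsmul_eq_mul]
    gcongr
    exacts [hψ i j, hN k (hMD hk), (Finset.sum_le_sum_of_subset_of_nonneg (hND k (hMD hk))
      fun l _ _ => hψ i l).trans (hS i hi)]
  have hfar : ∑ k ∈ D, ∑ _l ∈ N k, ψ i k ≤ G * S := by
    calc ∑ k ∈ D, ∑ _l ∈ N k, ψ i k ≤ ∑ k ∈ D, G * ψ i k := by
          refine Finset.sum_le_sum fun k hk => ?_
          rw [Finset.sum_const, nsmul_eq_mul]
          exact mul_le_mul_of_nonneg_right (hN k hk) (hψ i k)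
      _ ≤ G * S := by
          rw [← Finset.mul_sum]
          exact mul_le_mul_of_nonneg_left (hS i hi) hG
  have hnear : ∑ k ∈ D, ∑ l ∈ N k, (if k ∈ M i then ψ i j + ψ i l else 0) ≤
      G * (G * ψ i j + S) := by
    calc ∑ k ∈ D, ∑ l ∈ N k, (if k ∈ M i then ψ i j + ψ i l else 0)
        = ∑ k ∈ M i, ∑ l ∈ N k, (ψ i j + ψ i l) := by
          rw [← Finset.inter_eq_right.2 hMD, ← Finset.sum_ite_mem]
          refine Finset.sum_congr rfl fun k hk => ?_
          by_cases hkM : k ∈ M i <;> simp [hkM, hk]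
      _ ≤ (M i).card * (G * ψ i j + S) := by
          rw [← nsmul_eq_mul]
          exact Finset.sum_le_card_nsmul _ _ _ hrow
      _ ≤ _ := mul_le_mul_of_nonneg_right hM (add_nonneg (mul_nonneg hG (hψ i j)) hS₀)
  simp only [Finset.sum_add_distrib]
  linarith

theorem sum_sum_sum_sum_pair_le (hψ : ∀ i j, 0 ≤ ψ i j) (hS : ∀ i ∈ D, ∑ j ∈ D, ψ i j ≤ S)
    (hND : ∀ i ∈ D, N i ⊆ D) (hN : ∀ i ∈ D, ((N i).card : ℝ) ≤ G)
    (hMD : ∀ i ∈ D, M i ⊆ D) (hM : ∀ i ∈ D, ((M i).card : ℝ) ≤ G) :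
    ∑ i ∈ D, ∑ j ∈ N i, ∑ k ∈ D, ∑ l ∈ N k, (ψ i k + if k ∈ M i then ψ i j + ψ i l else 0) ≤
      D.card * (3 * S * G ^ 2) := by
  rw [← nsmul_eq_mul]
  refine Finset.sum_le_card_nsmul _ _ _ fun i hi => ?_
  have hG : 0 ≤ G := (Nat.cast_nonneg _).trans (hN i hi)
  have hS₀ : 0 ≤ S := (Finset.sum_nonneg fun j _ => hψ i j).trans (hS i hi)
  calc _ ≤ ∑ j ∈ N i, G * (2 * S + G * ψ i j) := Finset.sum_le_sum fun j _ =>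
        sum_sum_pair_le hψ hS hND hN hi (hMD i hi) (hM i hi) j
    _ = G * ((N i).card * (2 * S) + G * ∑ j ∈ N i, ψ i j) := by
        rw [← Finset.mul_sum, Finset.sum_add_distrib, Finset.sum_const, nsmul_eq_mul,
          ← Finset.mul_sum]
    _ ≤ G * (G * (2 * S) + G * S) := by
        gcongr
        exacts [hN i hi, (Finset.sum_le_sum_of_subset_of_nonneg (hND i hi)
          fun l _ _ => hψ i l).trans (hS i hi)]
    _ = 3 * S * G ^ 2 := by ring

end counting

/-- The sites of `D` within distance `r` of `i`. -/
def nbhd {E : Type*} [PseudoMetricSpace E] (D : Finset E) (r : ℝ) (i : E) : Finset E :=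
  D.filter fun j => dist i j ≤ r

theorem mem_nbhd {E : Type*} [PseudoMetricSpace E] {D : Finset E} {r : ℝ} {i j : E} :
    j ∈ nbhd D r i ↔ j ∈ D ∧ dist i j ≤ r := Finset.mem_filter

theorem nbhd_subset {E : Type*} [PseudoMetricSpace E] (D : Finset E) (r : ℝ) (i : E) :
    nbhd D r i ⊆ D := Finset.filter_subset _ _

theorem nbhd_mono {E : Type*} [PseudoMetricSpace E] (D : Finset E) {r r' : ℝ} (h : r ≤ r') (i : E) :
    nbhd D r i ⊆ nbhd D r' i := fun _ hj =>
  mem_nbhd.2 ⟨(mem_nbhd.1 hj).1, (mem_nbhd.1 hj).2.trans h⟩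

/-- The truncation of `Y i` at level `T`, centred at its mean. -/
def trunc {E Ω : Type*} [MeasurableSpace Ω] (μ : Measure Ω) (T : ℝ) (Y : E → Ω → ℝ) (i : E)
    (ω : Ω) : ℝ := clip T (Y i ω) - ∫ ω', clip T (Y i ω') ∂μ

section trunc

variable {E Ω : Type*} [MeasurableSpace Ω] {μ : Measure Ω} [IsProbabilityMeasure μ]
  {Y : E → Ω → ℝ} {T : ℝ}

theorem abs_clip_sub_integral_le (hT : 0 ≤ T) (i : E) (y : ℝ) :
    |clip T y - ∫ ω, clip T (Y i ω) ∂μ| ≤ 2 * T := by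
  have hmean : |∫ ω, clip T (Y i ω) ∂μ| ≤ T := by
    simpa using norm_integral_le_of_norm_le_const (μ := μ) (f := fun ω => clip T (Y i ω))
      (.of_forall fun ω => abs_clip_le hT (Y i ω))
  linarith [abs_sub (clip T y) (∫ ω, clip T (Y i ω) ∂μ), abs_clip_le hT y]

theorem abs_trunc_le (hT : 0 ≤ T) (i : E) (ω : Ω) : |trunc μ T Y i ω| ≤ 2 * T :=
  abs_clip_sub_integral_le hT i _

theorem abs_trunc_mul_trunc_le (hT : 0 ≤ T) (i j : E) (ω : Ω) :
    |(trunc μ T Y i * trunc μ T Y j) ω| ≤ (2 * T) ^ 2 := by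
  rw [Pi.mul_apply, abs_mul, sq]
  exact mul_le_mul (abs_trunc_le hT i ω) (abs_trunc_le hT j ω) (abs_nonneg _) (by positivity)

variable (μ Y) in
theorem bddLip_trunc {ι : Type*} [Fintype ι] (hT : 0 ≤ T) (i : E) (e : ι) :
    BddLip (fun x : ι → ℝ => clip T (x e) - ∫ ω, clip T (Y i ω) ∂μ) (2 * T) 1 :=
  .comp_eval (q := fun y => clip T y - ∫ ω, clip T (Y i ω) ∂μ) (abs_clip_sub_integral_le hT i)
    (by simpa using (lipschitzWith_clip T).sub (.const _)) e

end trunc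

namespace ArrayParams

/-- The constant in the decay of the covariances between products of two variables truncated at
level `T`. -/
def pairConst (p : ArrayParams) (T : ℝ) : ℝ :=
  2 * (2 * T) ^ 4 * (1 + p.s₀) ^ p.α + p.κ * (6 * (2 * T) ^ 3) * 2 ^ p.α

theorem pairConst_nonneg (p : ArrayParams) {T : ℝ} (hT : 0 ≤ T) : 0 ≤ p.pairConst T := by
  have := p.κ_nonneg
  have := p.one_le_s₀
  unfold pairConst
  positivity

end ArrayParams

namespace WeakArray

variable {E Ω : Type*} [PseudoMetricSpace E] [MeasurableSpace Ω] {p : ArrayParams}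
  {μ : Measure Ω} {Y : E → Ω → ℝ} {D : Finset E} {T r s : ℝ} {i j k l : E}

theorem measurable_trunc (hY : WeakArray p μ Y D) (hi : i ∈ D) : Measurable (trunc μ T Y i) :=
  ((lipschitzWith_clip T).continuous.measurable.comp (hY.measurable i hi)).sub_const _

variable [IsProbabilityMeasure μ]

theorem memLp_trunc (hY : WeakArray p μ Y D) (hT : 0 ≤ T) (hi : i ∈ D) (q : ℝ≥0∞) :
    MemLp (trunc μ T Y i) q μ :=
  .of_bound (hY.measurable_trunc hi).aestronglyMeasurable (2 * T) (.of_forall (abs_trunc_le hT i))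

theorem memLp_trunc_mul (hY : WeakArray p μ Y D) (hT : 0 ≤ T) (hi : i ∈ D) (hj : j ∈ D)
    (q : ℝ≥0∞) : MemLp (trunc μ T Y i * trunc μ T Y j) q μ :=
  (hY.memLp_trunc hT hj q).mul (hY.memLp_trunc hT hi ∞)

theorem integral_trunc (hY : WeakArray p μ Y D) (hT : 0 ≤ T) (hi : i ∈ D) :
    ∫ ω, trunc μ T Y i ω ∂μ = 0 := by
  have hclip : Integrable (fun ω => clip T (Y i ω)) μ :=
    (hY.memLp_comp hi (.clip hT)).integrable (by simp)
  simp only [trunc]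
  rw [integral_sub hclip (integrable_const _)]
  simp

theorem cov_trunc_eq_integral (hY : WeakArray p μ Y D) (hT : 0 ≤ T) (hi : i ∈ D) {Q : Ω → ℝ}
    (hQ : MemLp Q 2 μ) : cov[trunc μ T Y i, Q; μ] = ∫ ω, trunc μ T Y i ω * Q ω ∂μ := by
  rw [covariance_eq_sub (hY.memLp_trunc hT hi 2) hQ, hY.integral_trunc hT hi, zero_mul, sub_zero]
  rfl

theorem abs_cov_trunc_le (hY : WeakArray p μ Y D) (hT : 0 ≤ T) (hs : p.s₀ ≤ s)
    (hi : i ∈ D) (hj : j ∈ D) (hij : s ≤ dist i j) :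
    |cov[trunc μ T Y i, trunc μ T Y j; μ]| ≤ p.κ * s ^ (-p.α) * (2 * (2 * T)) := by
  refine (hY.cov_le {i} {j} (by simpa using hi) (by simpa using hj) (by simp) s hs
    (by simpa using hij) _ _ _ _ _ _ (bddLip_trunc μ Y hT i ⟨i, Finset.mem_singleton_self i⟩)
    (bddLip_trunc μ Y hT j ⟨j, Finset.mem_singleton_self j⟩)).trans (le_of_eq ?_)
  ring

theorem abs_cov_trunc_mul_le_of_pairs (hY : WeakArray p μ Y D) (hT : 0 ≤ T) (hs : p.s₀ ≤ s)
    (hi : i ∈ D) (hj : j ∈ D) (hk : k ∈ D) (hl : l ∈ D)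
    (hik : s ≤ dist i k) (hil : s ≤ dist i l) (hjk : s ≤ dist j k) (hjl : s ≤ dist j l) :
    |cov[trunc μ T Y i * trunc μ T Y j, trunc μ T Y k * trunc μ T Y l; μ]| ≤
      p.κ * s ^ (-p.α) * (4 * (2 * T) ^ 3) := by
  classical
  have hsub : ∀ {a b : E}, a ∈ D → b ∈ D → ({a, b} : Finset E) ⊆ D := fun ha hb =>
    Finset.insert_subset ha (Finset.singleton_subset_iff.2 hb)
  have hdist : ∀ a ∈ ({i, j} : Finset E), ∀ b ∈ ({k, l} : Finset E), s ≤ dist a b := by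
    simp only [Finset.mem_insert, Finset.mem_singleton]
    rintro a (rfl | rfl) b (rfl | rfl) <;> assumption
  refine (hY.cov_le {i, j} {k, l} (hsub hi hj) (hsub hk hl)
    (by linarith [Finset.card_le_two (a := i) (b := j), Finset.card_le_two (a := k) (b := l)])
    s hs hdist _ _ _ _ _ _
    ((bddLip_trunc μ Y hT i ⟨i, by simp⟩).mul (bddLip_trunc μ Y hT j ⟨j, by simp⟩))
    ((bddLip_trunc μ Y hT k ⟨k, by simp⟩).mul
      (bddLip_trunc μ Y hT l ⟨l, by simp⟩))).trans (le_of_eq ?_)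
  ring

theorem abs_cov_trunc_triple_le (hY : WeakArray p μ Y D) (hT : 0 ≤ T) (hs : p.s₀ ≤ s)
    (hi : i ∈ D) (hj : j ∈ D) (hk : k ∈ D) (hl : l ∈ D)
    (hij : s ≤ dist i j) (hik : s ≤ dist i k) (hil : s ≤ dist i l) :
    |cov[trunc μ T Y i, trunc μ T Y j * (trunc μ T Y k * trunc μ T Y l); μ]| ≤
      p.κ * s ^ (-p.α) * (4 * (2 * T) ^ 3) := by
  classical
  have hdist : ∀ a ∈ ({i} : Finset E), ∀ b ∈ ({j, k, l} : Finset E), s ≤ dist a b := by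
    simp only [Finset.mem_insert, Finset.mem_singleton]
    rintro a rfl b (rfl | rfl | rfl) <;> assumption
  refine (hY.cov_le {i} {j, k, l} (by simpa using hi)
    (Finset.insert_subset hj (Finset.insert_subset hk (Finset.singleton_subset_iff.2 hl)))
    (by rw [Finset.card_singleton]; linarith [Finset.card_le_three (a := j) (b := k) (c := l)])
    s hs hdist _ _ _ _ _ _ (bddLip_trunc μ Y hT i ⟨i, Finset.mem_singleton_self i⟩)
    ((bddLip_trunc μ Y hT j ⟨j, by simp⟩).mul
      ((bddLip_trunc μ Y hT k ⟨k, by simp⟩).mul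
        (bddLip_trunc μ Y hT l ⟨l, by simp⟩)))).trans (le_of_eq ?_)
  ring

theorem abs_cov_trunc_mul_le_of_isolated (hY : WeakArray p μ Y D) (hT : 0 ≤ T) (hs : p.s₀ ≤ s)
    (hi : i ∈ D) (hj : j ∈ D) (hk : k ∈ D) (hl : l ∈ D)
    (hij : s ≤ dist i j) (hik : s ≤ dist i k) (hil : s ≤ dist i l) :
    |cov[trunc μ T Y i * trunc μ T Y j, trunc μ T Y k * trunc μ T Y l; μ]| ≤
      p.κ * s ^ (-p.α) * (6 * (2 * T) ^ 3) := by
  have hs₀ : 0 ≤ s := by linarith [p.one_le_s₀]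
  have hκ := p.κ_nonneg
  have hjkl : MemLp (trunc μ T Y j * (trunc μ T Y k * trunc μ T Y l)) 2 μ :=
    (hY.memLp_trunc_mul hT hk hl ∞).mul (hY.memLp_trunc hT hj 2)
  -- As `trunc μ T Y i` is centred, it may be moved alone to the left of the covariance.
  have hsplit : cov[trunc μ T Y i * trunc μ T Y j, trunc μ T Y k * trunc μ T Y l; μ] =
      cov[trunc μ T Y i, trunc μ T Y j * (trunc μ T Y k * trunc μ T Y l); μ] -
      cov[trunc μ T Y i, trunc μ T Y j; μ] * ∫ ω, (trunc μ T Y k * trunc μ T Y l) ω ∂μ := by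
    rw [covariance_eq_sub (hY.memLp_trunc_mul hT hi hj 2) (hY.memLp_trunc_mul hT hk hl 2),
      hY.cov_trunc_eq_integral hT hi hjkl, hY.cov_trunc_eq_integral hT hi (hY.memLp_trunc hT hj 2)]
    simp only [Pi.mul_apply, mul_assoc]
  have hkl : |∫ ω, (trunc μ T Y k * trunc μ T Y l) ω ∂μ| ≤ (2 * T) ^ 2 := by
    simpa using norm_integral_le_of_norm_le_const (μ := μ)
      (f := trunc μ T Y k * trunc μ T Y l) (.of_forall (abs_trunc_mul_trunc_le hT k l))
  calc _ ≤ |cov[trunc μ T Y i, trunc μ T Y j * (trunc μ T Y k * trunc μ T Y l); μ]| +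
        |cov[trunc μ T Y i, trunc μ T Y j; μ]| *
          |∫ ω, (trunc μ T Y k * trunc μ T Y l) ω ∂μ| := by
        rw [hsplit, ← abs_mul]
        exact abs_sub _ _
    _ ≤ p.κ * s ^ (-p.α) * (4 * (2 * T) ^ 3) +
        p.κ * s ^ (-p.α) * (2 * (2 * T)) * (2 * T) ^ 2 := by
        gcongr
        exacts [hY.abs_cov_trunc_triple_le hT hs hi hj hk hl hij hik hil,
          hY.abs_cov_trunc_le hT hs hi hj hij]
    _ = p.κ * s ^ (-p.α) * (6 * (2 * T) ^ 3) := by ring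

theorem abs_cov_trunc_mul_le_of_decay (hY : WeakArray p μ Y D) (hT : 0 ≤ T) (hs : 0 ≤ s)
    (hi : i ∈ D) (hj : j ∈ D) (hk : k ∈ D) (hl : l ∈ D)
    (hdecay : p.s₀ ≤ s →
      |cov[trunc μ T Y i * trunc μ T Y j, trunc μ T Y k * trunc μ T Y l; μ]| ≤
        p.κ * s ^ (-p.α) * (6 * (2 * T) ^ 3)) :
    |cov[trunc μ T Y i * trunc μ T Y j, trunc μ T Y k * trunc μ T Y l; μ]| ≤
      p.pairConst T * (1 + s) ^ (-p.α) := by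
  have hκ := p.κ_nonneg
  refine le_mul_one_add_rpow_neg p.one_le_s₀ hs p.α_nonneg (by positivity) (by positivity) ?_
    fun h => (hdecay h).trans (le_of_eq (by ring))
  refine (abs_covariance_le_of_abs_le
    ((hY.measurable_trunc hi).mul (hY.measurable_trunc hj))
    ((hY.measurable_trunc hk).mul (hY.measurable_trunc hl))
    (abs_trunc_mul_trunc_le hT i j) (abs_trunc_mul_trunc_le hT k l)).trans (le_of_eq ?_)
  ring

theorem abs_cov_trunc_mul_le_near (hY : WeakArray p μ Y D) (hT : 0 ≤ T)
    (hi : i ∈ D) (hj : j ∈ D) (hk : k ∈ D) (hl : l ∈ D) :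
    |cov[trunc μ T Y i * trunc μ T Y j, trunc μ T Y k * trunc μ T Y l; μ]| ≤ p.pairConst T *
      ((1 + dist i k) ^ (-p.α) + ((1 + dist i j) ^ (-p.α) + (1 + dist i l) ^ (-p.α))) := by
  have hs : 0 ≤ min (dist i k) (min (dist i j) (dist i l)) := by positivity
  refine (hY.abs_cov_trunc_mul_le_of_decay hT hs hi hj hk hl fun h =>
    hY.abs_cov_trunc_mul_le_of_isolated hT h hi hj hk hl
      ((min_le_right _ _).trans (min_le_left _ _)) (min_le_left _ _)
      ((min_le_right _ _).trans (min_le_right _ _))).trans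
    (mul_le_mul_of_nonneg_left ?_ (p.pairConst_nonneg hT))
  exact (one_add_min_rpow_neg_le dist_nonneg (le_min dist_nonneg dist_nonneg)).trans
    (add_le_add_right (one_add_min_rpow_neg_le dist_nonneg dist_nonneg) _)

theorem abs_cov_trunc_mul_le_far (hY : WeakArray p μ Y D) (hT : 0 ≤ T)
    (hi : i ∈ D) (hj : j ∈ D) (hk : k ∈ D) (hl : l ∈ D) (hij : dist i j ≤ r) (hkl : dist k l ≤ r)
    (hik : 3 * r < dist i k) :
    |cov[trunc μ T Y i * trunc μ T Y j, trunc μ T Y k * trunc μ T Y l; μ]| ≤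
      p.pairConst T * 3 ^ p.α * (1 + dist i k) ^ (-p.α) := by
  have hκ := p.κ_nonneg
  have hT' := p.pairConst_nonneg hT
  have hd : 0 ≤ dist i k := dist_nonneg
  have hilk : dist i k ≤ dist i l + dist k l := dist_comm k l ▸ dist_triangle i l k
  have hijk : dist i k ≤ dist i j + dist j k := dist_triangle i j k
  have hjlk : dist j k ≤ dist j l + dist k l := dist_comm k l ▸ dist_triangle j l k
  refine (hY.abs_cov_trunc_mul_le_of_decay hT (s := dist i k / 3) (by positivity) hi hj hk hl
    fun h => ?_).trans ?_
  · have : 0 ≤ dist i k / 3 := by positivity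
    refine (hY.abs_cov_trunc_mul_le_of_pairs hT h hi hj hk hl (by linarith) (by linarith)
      (by linarith) (by linarith)).trans ?_
    gcongr
    norm_num
  · rw [mul_assoc]
    gcongr
    exact one_add_div_rpow_neg_le hd (by norm_num) p.α_nonneg

open scoped Classical in
theorem abs_cov_trunc_mul_le (hY : WeakArray p μ Y D) (hT : 0 ≤ T)
    (hi : i ∈ D) (hj : j ∈ nbhd D r i) (hk : k ∈ D) (hl : l ∈ nbhd D r k) :
    |cov[trunc μ T Y i * trunc μ T Y j, trunc μ T Y k * trunc μ T Y l; μ]| ≤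
      p.pairConst T * 3 ^ p.α * ((1 + dist i k) ^ (-p.α) + if k ∈ nbhd D (3 * r) i then
        (1 + dist i j) ^ (-p.α) + (1 + dist i l) ^ (-p.α) else 0) := by
  have hT' := p.pairConst_nonneg hT
  rw [mem_nbhd] at hj hl
  split_ifs with hik
  · refine (hY.abs_cov_trunc_mul_le_near hT hi hj.1 hk hl.1).trans ?_
    gcongr
    exact le_mul_of_one_le_right hT' (Real.one_le_rpow (by norm_num) p.α_nonneg)
  · rw [add_zero]
    refine hY.abs_cov_trunc_mul_le_far hT hi hj.1 hk hl.1 hj.2 hl.2 (not_le.1 fun h => hik ?_)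
    exact mem_nbhd.2 ⟨hk, h⟩

theorem variance_sum_trunc_mul_le (hY : WeakArray p μ Y D) {S G : ℝ} (hT : 0 ≤ T) (hr : 0 ≤ r)
    (hS : ∀ i ∈ D, ∑ j ∈ D, (1 + dist i j) ^ (-p.α) ≤ S)
    (hG : ∀ i ∈ D, ((nbhd D (3 * r) i).card : ℝ) ≤ G) :
    Var[fun ω => ∑ i ∈ D, trunc μ T Y i ω * ∑ j ∈ nbhd D r i, trunc μ T Y j ω; μ] ≤
      p.pairConst T * 3 ^ p.α * (D.card * (3 * S * G ^ 2)) := by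
  classical
  have hmem : ∀ q ∈ D.sigma (nbhd D r), MemLp (trunc μ T Y q.1 * trunc μ T Y q.2) 2 μ :=
    fun q hq => hY.memLp_trunc_mul hT (Finset.mem_sigma.1 hq).1
      (nbhd_subset _ _ _ (Finset.mem_sigma.1 hq).2) 2
  have hsum : (fun ω => ∑ i ∈ D, trunc μ T Y i ω * ∑ j ∈ nbhd D r i, trunc μ T Y j ω) =
      ∑ q ∈ D.sigma (nbhd D r), trunc μ T Y q.1 * trunc μ T Y q.2 := by
    ext ω
    simp only [Finset.sum_apply, Pi.mul_apply, Finset.mul_sum, Finset.sum_sigma']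
  have hcard : ∀ i ∈ D, ((nbhd D r i).card : ℝ) ≤ G := fun i hi =>
    le_trans (by exact_mod_cast Finset.card_le_card (nbhd_mono D (by linarith) i)) (hG i hi)
  calc _ = ∑ i ∈ D, ∑ j ∈ nbhd D r i, ∑ k ∈ D, ∑ l ∈ nbhd D r k,
        cov[trunc μ T Y i * trunc μ T Y j, trunc μ T Y k * trunc μ T Y l; μ] := by
        rw [hsum, variance_sum' hmem]
        simp only [Finset.sum_sigma]
    _ ≤ ∑ i ∈ D, ∑ j ∈ nbhd D r i, ∑ k ∈ D, ∑ l ∈ nbhd D r k, p.pairConst T * 3 ^ p.α *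
        ((1 + dist i k) ^ (-p.α) + if k ∈ nbhd D (3 * r) i then
          (1 + dist i j) ^ (-p.α) + (1 + dist i l) ^ (-p.α) else 0) := by
        gcongr with i hi j hj k hk l hl
        exact (le_abs_self _).trans (hY.abs_cov_trunc_mul_le hT hi hj hk hl)
    _ ≤ _ := by
        simp only [← Finset.mul_sum]
        have := p.pairConst_nonneg hT
        gcongr
        exact sum_sum_sum_sum_pair_le (fun i j => by positivity) hS (fun i _ => nbhd_subset D r i)
          hcard (fun i _ => nbhd_subset D _ i) hG

end WeakArray

section charFun

variable {Ω : Type*} [MeasurableSpace Ω] {μ : Measure Ω}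

theorem charFun_map {W : Ω → ℝ} (hW : AEMeasurable W μ) (t : ℝ) :
    charFun (μ.map W) t = ∫ ω, Complex.exp ((t * W ω : ℝ) * Complex.I) ∂μ := by
  rw [charFun_apply_real, integral_map hW (by fun_prop)]
  simp only [Complex.ofReal_mul]

theorem integrable_ofReal_mul_exp {Z V : Ω → ℝ} (hZ : Integrable Z μ) (hV : AEMeasurable V μ) :
    Integrable (fun ω => (Z ω : ℂ) * Complex.exp (V ω * Complex.I)) μ :=
  hZ.ofReal.mul_bdd (c := 1) (by fun_prop)
    (.of_forall fun ω => (Complex.norm_exp_ofReal_mul_I (V ω)).le)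

theorem norm_integral_ofReal_mul_exp_le {Z V : Ω → ℝ} (hZ : Integrable Z μ)
    (hV : AEMeasurable V μ) :
    ‖∫ ω, (Z ω : ℂ) * Complex.exp (V ω * Complex.I) ∂μ‖ ≤
      |∫ ω, Real.cos (V ω) * Z ω ∂μ| + |∫ ω, Real.sin (V ω) * Z ω ∂μ| := by
  have hcos : Integrable (fun ω => Real.cos (V ω) * Z ω) μ :=
    hZ.bdd_mul (c := 1) (by fun_prop) (.of_forall fun ω => Real.abs_cos_le_one _)
  have hsin : Integrable (fun ω => Real.sin (V ω) * Z ω) μ :=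
    hZ.bdd_mul (c := 1) (by fun_prop) (.of_forall fun ω => Real.abs_sin_le_one _)
  have hsplit : ∀ ω, (Z ω : ℂ) * Complex.exp (V ω * Complex.I) =
      ((Real.cos (V ω) * Z ω : ℝ) : ℂ) + ((Real.sin (V ω) * Z ω : ℝ) : ℂ) * Complex.I := fun ω => by
    rw [Complex.exp_mul_I]
    push_cast
    ring
  simp_rw [hsplit]
  rw [integral_add hcos.ofReal (hsin.ofReal.mul_const _), integral_mul_const,
    integral_complex_ofReal, integral_complex_ofReal]
  refine (norm_add_le _ _).trans (le_of_eq ?_)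
  simp

variable [IsProbabilityMeasure μ]

theorem norm_charFun_map_sub_charFun_map_le {W W' : Ω → ℝ} (hW : Integrable W μ)
    (hW' : Integrable W' μ) (t : ℝ) :
    ‖charFun (μ.map W) t - charFun (μ.map W') t‖ ≤ |t| * ∫ ω, |W ω - W' ω| ∂μ := by
  have hexp : ∀ {V : Ω → ℝ}, Integrable V μ →
      Integrable (fun ω => Complex.exp ((t * V ω : ℝ) * Complex.I)) μ := fun hV => by
    simpa using integrable_ofReal_mul_exp (integrable_const (1 : ℝ)) (hV.aemeasurable.const_mul t)
  have hlip : ∀ x y : ℝ, ‖Complex.exp (x * Complex.I) - Complex.exp (y * Complex.I)‖ ≤ |x - y| :=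
    fun x y => by
      have hfactor : Complex.exp (x * Complex.I) - Complex.exp (y * Complex.I) =
          Complex.exp (y * Complex.I) * (Complex.exp (Complex.I * ((x - y : ℝ) : ℂ)) - 1) := by
        rw [mul_sub, mul_one, ← Complex.exp_add]
        push_cast
        ring_nf
      rw [hfactor, norm_mul, Complex.norm_exp_ofReal_mul_I, one_mul]
      exact Real.norm_exp_I_mul_ofReal_sub_one_le
  rw [charFun_map hW.aemeasurable, charFun_map hW'.aemeasurable,
    ← integral_sub (hexp hW) (hexp hW'), ← integral_const_mul]
  refine norm_integral_le_of_norm_le ((hW.sub hW').abs.const_mul _) (.of_forall fun ω => ?_)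
  refine (hlip _ _).trans (le_of_eq ?_)
  rw [← mul_sub, abs_mul]

theorem differentiable_charFun_map {W : Ω → ℝ} (hW : Integrable W μ) :
    Differentiable ℝ (charFun (μ.map W)) := by
  have := Measure.isProbabilityMeasure_map (μ := μ) hW.aemeasurable
  exact (contDiff_charFun (n := 1) (by
    simpa using (memLp_map_measure_iff (p := 1) aestronglyMeasurable_id hW.aemeasurable).2
      (memLp_one_iff_integrable.2 hW))).differentiable (by simp)

theorem deriv_charFun_map_add {W : Ω → ℝ} (hW : Integrable W μ) (t : ℝ) :
    deriv (charFun (μ.map W)) t + t * charFun (μ.map W) t =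
      ∫ ω, (Complex.I * W ω + t) * Complex.exp ((t * W ω : ℝ) * Complex.I) ∂μ := by
  have := Measure.isProbabilityMeasure_map (μ := μ) hW.aemeasurable
  have hderiv : deriv (charFun (μ.map W)) t =
      ∫ ω, Complex.I * (W ω * Complex.exp ((t * W ω : ℝ) * Complex.I)) ∂μ := by
    rw [← iteratedDeriv_one, iteratedDeriv_charFun (n := 1) (by
        simpa using (memLp_map_measure_iff (p := 1) aestronglyMeasurable_id hW.aemeasurable).2
          (memLp_one_iff_integrable.2 hW)),
      integral_map hW.aemeasurable (by fun_prop), integral_const_mul]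
    simp only [pow_one, Complex.ofReal_mul]
  have htW : AEMeasurable (fun ω => t * W ω) μ := hW.aemeasurable.const_mul t
  rw [hderiv, charFun_map hW.aemeasurable, ← integral_const_mul,
    ← integral_add ((integrable_ofReal_mul_exp hW htW).const_mul _) (by
      simpa using (integrable_ofReal_mul_exp (integrable_const (1 : ℝ)) htW).const_mul (t : ℂ))]
  simp only [add_mul, mul_assoc]

end charFun

theorem norm_sub_exp_le_of_norm_deriv_add_le {f : ℝ → ℂ} (hf : Differentiable ℝ f) (hf₀ : f 0 = 1)
    {t ε : ℝ} (h : ∀ s : ℝ, |s| ≤ |t| → ‖deriv f s + s * f s‖ ≤ ε) :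
    ‖f t - Complex.exp (-(t : ℂ) ^ 2 / 2)‖ ≤ ε * |t| := by
  have hderiv : ∀ s : ℝ, HasDerivAt (fun s : ℝ => f s * Complex.exp ((s : ℂ) ^ 2 / 2))
      ((deriv f s + s * f s) * Complex.exp ((s : ℂ) ^ 2 / 2)) s := fun s => by
    have hsq : HasDerivAt (fun s : ℝ => (s : ℂ) ^ 2 / 2) (s : ℂ) s :=
      (((hasDerivAt_id s).ofReal_comp.pow 2).div_const 2).congr_deriv (by simp)
    exact ((hf s).hasDerivAt.mul hsq.cexp).congr_deriv (by ring)
  have hnorm : ∀ s : ℝ, ‖Complex.exp ((s : ℂ) ^ 2 / 2)‖ = Real.exp (s ^ 2 / 2) := fun s => by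
    rw [Complex.norm_exp]
    norm_cast
  have hε : 0 ≤ ε := (norm_nonneg _).trans (h t le_rfl)
  have hmean : ‖f t * Complex.exp ((t : ℂ) ^ 2 / 2) - 1‖ ≤ ε * Real.exp (t ^ 2 / 2) * |t| := by
    simpa [hf₀] using Convex.norm_image_sub_le_of_norm_hasDerivWithin_le
      (s := Set.Icc (-|t|) |t|) (C := ε * Real.exp (t ^ 2 / 2))
      (fun s _ => (hderiv s).hasDerivWithinAt)
      (fun s hs => by
        have hst : |s| ≤ |t| := abs_le.2 hs
        rw [norm_mul, hnorm]
        exact mul_le_mul (h s hst)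
          (Real.exp_le_exp.2 (div_le_div_of_nonneg_right (sq_le_sq.2 hst) two_pos.le))
          (Real.exp_pos _).le hε)
      (convex_Icc _ _) (x := 0) (y := t) (by simp) (abs_le.1 le_rfl)
  have hfactor : (f t - Complex.exp (-(t : ℂ) ^ 2 / 2)) * Complex.exp ((t : ℂ) ^ 2 / 2) =
      f t * Complex.exp ((t : ℂ) ^ 2 / 2) - 1 := by
    rw [sub_mul, ← Complex.exp_add, neg_div, neg_add_cancel, Complex.exp_zero]
  rw [← hfactor, norm_mul, hnorm, mul_right_comm] at hmean
  exact le_of_mul_le_mul_right hmean (Real.exp_pos _)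

theorem norm_one_sub_sub_exp_le (x : ℝ) :
    ‖1 - x * Complex.I - Complex.exp (-(x * Complex.I))‖ ≤ 2 * x ^ 2 := by
  have hx : ‖-(x * Complex.I)‖ = |x| := by simp
  rw [norm_sub_rev, ← sq_abs]
  rcases le_or_gt |x| 1 with h | h
  · have hquad := Complex.norm_exp_sub_one_sub_id_le (x := -(x * Complex.I)) (hx.trans_le h)
    rw [hx] at hquad
    calc _ = ‖Complex.exp (-(x * Complex.I)) - 1 - -(x * Complex.I)‖ := by ring_nf
      _ ≤ |x| ^ 2 := hquad
      _ ≤ 2 * |x| ^ 2 := by linarith [sq_nonneg |x|]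
  · have hlin : ‖Complex.exp (-(x * Complex.I)) - 1‖ ≤ |x| := by
      simpa [mul_comm] using Real.norm_exp_I_mul_ofReal_sub_one_le (x := -x)
    calc _ = ‖Complex.exp (-(x * Complex.I)) - 1 - -(x * Complex.I)‖ := by ring_nf
      _ ≤ |x| + |x| := (norm_sub_le _ _).trans (add_le_add hlin hx.le)
      _ ≤ 2 * |x| ^ 2 := by nlinarith

section Stein

variable {ι : Type*} {D : Finset ι} {B σ : ℝ}

/-- With `U i` a partial sum of the `z j` over a neighbourhood of `i`, the exponential on the left
is expanded to first order around the sum over the complement of that neighbourhood. -/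
theorem stein_identity {z U : ι → ℝ} (hσ : σ ≠ 0) (t : ℝ) :
    (Complex.I * ((σ⁻¹ * ∑ i ∈ D, z i : ℝ) : ℂ) + t) *
        Complex.exp ((t * (σ⁻¹ * ∑ i ∈ D, z i) : ℝ) * Complex.I) =
      Complex.I * (σ : ℂ)⁻¹ * ∑ i ∈ D, z i *
          Complex.exp ((t * σ⁻¹ * (∑ j ∈ D, z j - U i) : ℝ) * Complex.I) +
        (t * (1 - (σ ^ 2)⁻¹ * ∑ i ∈ D, z i * U i) : ℝ) *
          Complex.exp ((t * (σ⁻¹ * ∑ i ∈ D, z i) : ℝ) * Complex.I) +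
        Complex.I * (σ : ℂ)⁻¹ * Complex.exp ((t * (σ⁻¹ * ∑ i ∈ D, z i) : ℝ) * Complex.I) *
          ∑ i ∈ D, z i * (1 - (t * σ⁻¹ * U i : ℝ) * Complex.I -
            Complex.exp (-((t * σ⁻¹ * U i : ℝ) * Complex.I))) := by
  set e := Complex.exp ((t * (σ⁻¹ * ∑ i ∈ D, z i) : ℝ) * Complex.I) with he
  have hσ' : (σ : ℂ) ≠ 0 := by exact_mod_cast hσ
  have hexp : ∀ i, Complex.exp ((t * σ⁻¹ * (∑ j ∈ D, z j - U i) : ℝ) * Complex.I) =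
      e * Complex.exp (-((t * σ⁻¹ * U i : ℝ) * Complex.I)) := fun i => by
    rw [he, ← Complex.exp_add]
    push_cast
    ring_nf
  have hsum : ∑ i ∈ D, (z i : ℂ) * (e * Complex.exp (-((t * σ⁻¹ * U i : ℝ) * Complex.I))) +
      e * ∑ i ∈ D, z i * (1 - (t * σ⁻¹ * U i : ℝ) * Complex.I -
        Complex.exp (-((t * σ⁻¹ * U i : ℝ) * Complex.I))) =
      e * (∑ i ∈ D, (z i : ℂ) - t * (σ : ℂ)⁻¹ * Complex.I * ∑ i ∈ D, (z i : ℂ) * U i) := by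
    rw [Finset.mul_sum, ← Finset.sum_add_distrib, Finset.mul_sum (f := fun i => (z i : ℂ) * U i),
      ← Finset.sum_sub_distrib, Finset.mul_sum]
    refine Finset.sum_congr rfl fun i _ => ?_
    push_cast
    ring
  simp only [hexp]
  rw [add_right_comm, mul_assoc _ e, ← mul_add, hsum]
  push_cast
  field_simp
  linear_combination (t * e * ∑ i ∈ D, (z i : ℂ) * U i) * Complex.I_sq

theorem norm_stein_sub_le {z U : ι → ℝ} (hz : ∀ i ∈ D, |z i| ≤ B) (hσ : 0 < σ) (t : ℝ) :
    ‖(Complex.I * ((σ⁻¹ * ∑ i ∈ D, z i : ℝ) : ℂ) + t) *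
        Complex.exp ((t * (σ⁻¹ * ∑ i ∈ D, z i) : ℝ) * Complex.I) -
      Complex.I * (σ : ℂ)⁻¹ * ∑ i ∈ D, z i *
          Complex.exp ((t * σ⁻¹ * (∑ j ∈ D, z j - U i) : ℝ) * Complex.I)‖ ≤
      |t| * |1 - (σ ^ 2)⁻¹ * ∑ i ∈ D, z i * U i| +
        2 * (σ ^ 3)⁻¹ * B * t ^ 2 * ∑ i ∈ D, U i ^ 2 := by
  have hTaylor : ‖∑ i ∈ D, (z i : ℂ) * (1 - (t * σ⁻¹ * U i : ℝ) * Complex.I -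
      Complex.exp (-((t * σ⁻¹ * U i : ℝ) * Complex.I)))‖ ≤
      ∑ i ∈ D, B * (2 * (t * σ⁻¹ * U i) ^ 2) := by
    refine norm_sum_le_of_le _ fun i hi => ?_
    rw [norm_mul, Complex.norm_real]
    exact mul_le_mul (hz i hi) (norm_one_sub_sub_exp_le _) (norm_nonneg _)
      ((abs_nonneg _).trans (hz i hi))
  rw [stein_identity hσ.ne' t, add_assoc, add_sub_cancel_left]
  refine (norm_add_le _ _).trans (add_le_add ?_ ?_)
  · rw [norm_mul, Complex.norm_exp_ofReal_mul_I, mul_one, Complex.norm_real, Real.norm_eq_abs,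
      abs_mul]
  · rw [norm_mul, norm_mul, norm_mul, Complex.norm_exp_ofReal_mul_I, Complex.norm_I, one_mul,
      mul_one, norm_inv, Complex.norm_real, Real.norm_eq_abs, abs_of_pos hσ]
    calc _ ≤ σ⁻¹ * ∑ i ∈ D, B * (2 * (t * σ⁻¹ * U i) ^ 2) := by gcongr
      _ = _ := by
        rw [Finset.mul_sum, Finset.mul_sum]
        refine Finset.sum_congr rfl fun i _ => ?_
        field_simp

variable {Ω : Type*} [MeasurableSpace Ω] {μ : Measure Ω} [IsProbabilityMeasure μ]

theorem norm_deriv_charFun_add_le {Z U : ι → Ω → ℝ} (hZ : ∀ i ∈ D, MemLp (Z i) 2 μ)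
    (hZB : ∀ i ∈ D, ∀ ω, |Z i ω| ≤ B) (hU : ∀ i ∈ D, MemLp (U i) 2 μ) (hσ : 0 < σ) (t : ℝ) :
    ‖deriv (charFun (μ.map fun ω => σ⁻¹ * ∑ i ∈ D, Z i ω)) t +
        t * charFun (μ.map fun ω => σ⁻¹ * ∑ i ∈ D, Z i ω) t‖ ≤
      σ⁻¹ * ∑ i ∈ D, ‖∫ ω, (Z i ω : ℂ) * Complex.exp
        ((t * σ⁻¹ * (∑ j ∈ D, Z j ω - U i ω) : ℝ) * Complex.I) ∂μ‖ +
      (|t| * ∫ ω, |1 - (σ ^ 2)⁻¹ * ∑ i ∈ D, Z i ω * U i ω| ∂μ +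
        2 * (σ ^ 3)⁻¹ * B * t ^ 2 * ∑ i ∈ D, ∫ ω, U i ω ^ 2 ∂μ) := by
  have hZint : ∀ i ∈ D, Integrable (Z i) μ := fun i hi => (hZ i hi).integrable (by simp)
  have hS : Integrable (fun ω => ∑ i ∈ D, Z i ω) μ := integrable_finsetSum _ hZint
  have hW : Integrable (fun ω => σ⁻¹ * ∑ i ∈ D, Z i ω) μ := hS.const_mul _
  have hfar : ∀ i ∈ D, Integrable (fun ω => (Z i ω : ℂ) * Complex.exp
      ((t * σ⁻¹ * (∑ j ∈ D, Z j ω - U i ω) : ℝ) * Complex.I)) μ := fun i hi =>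
    integrable_ofReal_mul_exp (hZint i hi)
      ((hS.sub ((hU i hi).integrable (by simp))).aemeasurable.const_mul _)
  have hlocal : Integrable (fun ω => |1 - (σ ^ 2)⁻¹ * ∑ i ∈ D, Z i ω * U i ω|) μ :=
    ((integrable_const 1).sub ((integrable_finsetSum _ fun i hi =>
      (hZ i hi).integrable_mul (hU i hi)).const_mul _)).abs
  have hsq : ∀ i ∈ D, Integrable (fun ω => U i ω ^ 2) μ := fun i hi => (hU i hi).integrable_sq
  have hfarSum := (integrable_finsetSum D hfar).const_mul (Complex.I * (σ : ℂ)⁻¹)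
  have hdefect : Integrable (fun ω => (Complex.I * ((σ⁻¹ * ∑ i ∈ D, Z i ω : ℝ) : ℂ) + t) *
      Complex.exp ((t * (σ⁻¹ * ∑ i ∈ D, Z i ω) : ℝ) * Complex.I)) μ := by
    refine ((hW.ofReal.const_mul _).add (integrable_const _)).mul_bdd (c := 1) ?_
      (.of_forall fun ω => (Complex.norm_exp_ofReal_mul_I _).le)
    have := hW.aestronglyMeasurable
    fun_prop
  rw [deriv_charFun_map_add hW, ← sub_add_cancel (∫ ω, _ ∂μ) (∫ ω, Complex.I * (σ : ℂ)⁻¹ *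
    ∑ i ∈ D, (Z i ω : ℂ) * Complex.exp ((t * σ⁻¹ * (∑ j ∈ D, Z j ω - U i ω) : ℝ) * Complex.I) ∂μ),
    ← integral_sub hdefect hfarSum, add_comm]
  refine (norm_add_le _ _).trans (add_le_add ?_ ?_)
  · rw [integral_const_mul, integral_finsetSum _ hfar, norm_mul, norm_mul, Complex.norm_I, one_mul,
      norm_inv, Complex.norm_real, Real.norm_eq_abs, abs_of_pos hσ]
    gcongr
    exact norm_sum_le _ _
  · rw [← integral_const_mul, ← integral_finsetSum _ hsq, ← integral_const_mul,
      ← integral_add (hlocal.const_mul _) ((integrable_finsetSum _ hsq).const_mul _)]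
    exact norm_integral_le_of_norm_le
      ((hlocal.const_mul _).add ((integrable_finsetSum _ hsq).const_mul _))
      (.of_forall fun ω => norm_stein_sub_le (fun i hi => hZB i hi ω) hσ t)

end Stein

section deviation

variable {Ω : Type*} [MeasurableSpace Ω] {μ : Measure Ω} [IsProbabilityMeasure μ] {Q : Ω → ℝ}

theorem integral_abs_le_sqrt_integral_sq (hQ : MemLp Q 2 μ) :
    ∫ ω, |Q ω| ∂μ ≤ √(∫ ω, Q ω ^ 2 ∂μ) := by
  refine Real.le_sqrt_of_sq_le ?_
  have h := variance_nonneg |Q| μ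
  rw [variance_eq_sub hQ.abs] at h
  simpa using h

theorem integral_abs_const_sub_le (hQ : MemLp Q 2 μ) (c : ℝ) :
    ∫ ω, |c - Q ω| ∂μ ≤ |c - ∫ ω, Q ω ∂μ| + √Var[Q; μ] := by
  have hcentred : MemLp (fun ω => Q ω - ∫ ω', Q ω' ∂μ) 2 μ := hQ.sub (memLp_const _)
  have habs : Integrable (fun ω => |Q ω - ∫ ω', Q ω' ∂μ|) μ :=
    (hcentred.integrable (by simp)).abs
  calc ∫ ω, |c - Q ω| ∂μ
      ≤ ∫ ω, (|c - ∫ ω', Q ω' ∂μ| + |Q ω - ∫ ω', Q ω' ∂μ|) ∂μ := by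
        refine integral_mono ((integrable_const c).sub (hQ.integrable (by simp))).abs
          ((integrable_const _).add habs) fun ω => ?_
        simpa using abs_sub (c - ∫ ω', Q ω' ∂μ) (Q ω - ∫ ω', Q ω' ∂μ)
    _ = |c - ∫ ω', Q ω' ∂μ| + ∫ ω, |Q ω - ∫ ω', Q ω' ∂μ| ∂μ := by
        rw [integral_add (integrable_const _) habs]
        simp
    _ ≤ _ := by
        rw [variance_eq_integral hQ.aestronglyMeasurable.aemeasurable]
        gcongr
        exact integral_abs_le_sqrt_integral_sq hcentred

end deviation

theorem abs_sum_sum_le {ι : Type*} {N : Finset ι} {M : ι → Finset ι} {c ψ : ι → ι → ℝ} {C S : ℝ}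
    (hC : 0 ≤ C) (hc : ∀ i ∈ N, ∀ j ∈ M i, |c i j| ≤ C * ψ i j)
    (hS : ∀ i ∈ N, ∑ j ∈ M i, ψ i j ≤ S) : |∑ i ∈ N, ∑ j ∈ M i, c i j| ≤ N.card * (C * S) := by
  rw [← nsmul_eq_mul]
  refine (Finset.abs_sum_le_sum_abs _ _).trans (Finset.sum_le_card_nsmul _ _ _ fun i hi => ?_)
  calc |∑ j ∈ M i, c i j| ≤ ∑ j ∈ M i, |c i j| := Finset.abs_sum_le_sum_abs _ _
    _ ≤ ∑ j ∈ M i, C * ψ i j := Finset.sum_le_sum (hc i hi)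
    _ ≤ C * S := by
      rw [← Finset.mul_sum]
      exact mul_le_mul_of_nonneg_left (hS i hi) hC

theorem sum_rpow_neg_le_of_le {E : Type*} [PseudoMetricSpace E] {F : Finset E} {i : E} {a b S : ℝ}
    (hba : b ≤ a) (hS : ∑ j ∈ F, (1 + dist i j) ^ (-b) ≤ S) :
    ∑ j ∈ F, (1 + dist i j) ^ (-a) ≤ S :=
  (Finset.sum_le_sum fun _ _ => Real.rpow_le_rpow_of_exponent_le
    (le_add_of_nonneg_right dist_nonneg) (neg_le_neg hba)).trans hS

theorem ArrayParams.rate_le (p : ArrayParams) : p.rate ≤ p.α := by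
  have hm := p.two_lt_m
  rw [rate, div_le_iff₀ (by linarith)]
  nlinarith [p.α_nonneg]

/-- The covariances of the truncated variables with bounded, slowly varying functions of the
variables at distance at least `r` are at most `e`. Here `ℓ` bounds the Lipschitz constants. -/
def LongRange {E Ω : Type*} [PseudoMetricSpace E] [MeasurableSpace Ω] (μ : Measure Ω)
    (Y : E → Ω → ℝ) (D : Finset E) (T r ℓ e : ℝ) : Prop :=
  ∀ i ∈ D, ∀ U ⊆ D, (∀ j ∈ U, r ≤ dist j i) → ∀ f : (U → ℝ) → ℝ, BddLip f 1 ℓ →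
    |cov[fun ω => f (restr Y U ω), fun ω => clip T (Y i ω); μ]| ≤ e

namespace WeakArray

variable {E Ω : Type*} [PseudoMetricSpace E] [MeasurableSpace Ω] {p : ArrayParams}
  {μ : Measure Ω} [IsProbabilityMeasure μ] {Y : E → Ω → ℝ} {D : Finset E}
  {T r b S G ℓ e σ w t : ℝ} {i j : E}

theorem cov_trunc_left (hY : WeakArray p μ Y D) (hT : 0 ≤ T) (hi : i ∈ D) (Q : Ω → ℝ) :
    cov[trunc μ T Y i, Q; μ] = cov[fun ω => clip T (Y i ω), Q; μ] :=
  covariance_sub_const_left ((hY.memLp_comp hi (.clip hT)).integrable (by simp)) _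

theorem cov_trunc_trunc (hY : WeakArray p μ Y D) (hT : 0 ≤ T) (hi : i ∈ D) (hj : j ∈ D) :
    cov[trunc μ T Y i, trunc μ T Y j; μ] =
      cov[fun ω => clip T (Y i ω), fun ω => clip T (Y j ω); μ] := by
  rw [hY.cov_trunc_left hT hi, covariance_comm, hY.cov_trunc_left hT hj, covariance_comm]

theorem abs_cov_trunc_trunc_le (hY : WeakArray p μ Y D) (hT : 0 ≤ T) (hi : i ∈ D) (hj : j ∈ D) :
    |cov[trunc μ T Y i, trunc μ T Y j; μ]| ≤ p.covConst * (1 + dist i j) ^ (-p.rate) := by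
  rw [hY.cov_trunc_trunc hT hi hj]
  exact hY.abs_cov_le hi hj (.clip hT) (.clip hT)

theorem integral_sum_mul_sum_trunc (hY : WeakArray p μ Y D) (hT : 0 ≤ T) {N : Finset E}
    (hN : N ⊆ D) {M : E → Finset E} (hM : ∀ i ∈ N, M i ⊆ D) :
    ∫ ω, ∑ i ∈ N, trunc μ T Y i ω * ∑ j ∈ M i, trunc μ T Y j ω ∂μ =
      ∑ i ∈ N, ∑ j ∈ M i, cov[trunc μ T Y i, trunc μ T Y j; μ] := by
  have hint : ∀ i ∈ N, ∀ j ∈ M i, Integrable (fun ω => trunc μ T Y i ω * trunc μ T Y j ω) μ :=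
    fun i hi j hj => (hY.memLp_trunc_mul hT (hN hi) (hM i hi hj) 1).integrable le_rfl
  simp_rw [Finset.mul_sum]
  rw [integral_finsetSum _ fun i hi => integrable_finsetSum _ (hint i hi)]
  refine Finset.sum_congr rfl fun i hi => ?_
  rw [integral_finsetSum _ (hint i hi)]
  exact Finset.sum_congr rfl fun j hj =>
    (hY.cov_trunc_eq_integral hT (hN hi) (hY.memLp_trunc hT (hM i hi hj) 2)).symm

theorem integral_sum_trunc_sq_le (hY : WeakArray p μ Y D) (hT : 0 ≤ T)
    (hS : ∀ i ∈ D, ∑ j ∈ D, (1 + dist i j) ^ (-p.rate) ≤ S) {N : Finset E} (hN : N ⊆ D) :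
    ∫ ω, (∑ j ∈ N, trunc μ T Y j ω) ^ 2 ∂μ ≤ N.card * (p.covConst * S) := by
  simp_rw [sq, Finset.sum_mul]
  rw [hY.integral_sum_mul_sum_trunc hT hN fun _ _ => hN]
  exact (le_abs_self _).trans (abs_sum_sum_le p.covConst_nonneg
    (fun i hi j hj => hY.abs_cov_trunc_trunc_le hT (hN hi) (hN hj)) fun i hi =>
      (Finset.sum_le_sum_of_subset_of_nonneg hN fun _ _ _ => by positivity).trans (hS i (hN hi)))

theorem abs_cov_sub_cov_trunc_le (hY : WeakArray p μ Y D) (hT : 0 < T) (hb : 0 ≤ b)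
    (hb' : b < p.rate) (hi : i ∈ D) (hj : j ∈ D) :
    |cov[Y i, Y j; μ] - cov[trunc μ T Y i, trunc μ T Y j; μ]| ≤
      2 * p.tailConst b T * (1 + dist i j) ^ (-b) := by
  have hclip : IsNormalContraction (clip T) := .clip hT.le
  have hsplit : cov[Y i, Y j; μ] - cov[trunc μ T Y i, trunc μ T Y j; μ] =
      cov[fun ω => Y i ω - clip T (Y i ω), fun ω => Y j ω; μ] +
        cov[fun ω => Y j ω - clip T (Y j ω), fun ω => clip T (Y i ω); μ] := by
    rw [hY.cov_trunc_trunc hT.le hi hj,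
      covariance_fun_sub_left (hY.memLp hi) (hY.memLp_comp hi hclip) (hY.memLp hj),
      covariance_fun_sub_left (hY.memLp hj) (hY.memLp_comp hj hclip) (hY.memLp_comp hi hclip),
      covariance_comm (Y j) fun ω => clip T (Y i ω),
      covariance_comm (fun ω => clip T (Y j ω)) fun ω => clip T (Y i ω)]
    ring
  have hij := hY.abs_cov_sub_clip_le hi hj hT .id hb hb'
  have hji := hY.abs_cov_sub_clip_le hj hi hT hclip hb hb'
  rw [dist_comm j i] at hji
  rw [hsplit]
  refine (abs_add_le _ _).trans ?_
  linarith

theorem abs_variance_sub_integral_le (hY : WeakArray p μ Y D) (hT : 0 < T) (hr : 0 ≤ r)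
    (hb : 0 ≤ b) (hb' : b < p.rate) (hS : ∀ i ∈ D, ∑ j ∈ D, (1 + dist i j) ^ (-b) ≤ S) :
    |Var[fun ω => ∑ i ∈ D, Y i ω; μ] -
        ∫ ω, ∑ i ∈ D, trunc μ T Y i ω * ∑ j ∈ nbhd D r i, trunc μ T Y j ω ∂μ| ≤
      D.card * (2 * p.tailConst b T * S + p.covConst * ((1 + r) ^ (-(p.rate - b)) * S)) := by
  have hY₂ : ∀ i ∈ D, MemLp (Y i) 2 μ := fun i hi => hY.memLp hi
  have hvar : Var[fun ω => ∑ i ∈ D, Y i ω; μ] = ∑ i ∈ D, ∑ j ∈ D, cov[Y i, Y j; μ] := by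
    rw [← covariance_self (memLp_finsetSum D hY₂).aestronglyMeasurable.aemeasurable,
      covariance_fun_sum_fun_sum' hY₂ hY₂]
  have hnear : |∑ i ∈ D, ∑ j ∈ D, (cov[Y i, Y j; μ] - cov[trunc μ T Y i, trunc μ T Y j; μ])| ≤
      D.card * (2 * p.tailConst b T * S) :=
    abs_sum_sum_le (mul_nonneg zero_le_two (p.tailConst_nonneg b hT.le))
      (fun i hi j hj => hY.abs_cov_sub_cov_trunc_le hT hb hb' hi hj) hS
  have hfar : |∑ i ∈ D, ∑ j ∈ D with ¬ dist i j ≤ r, cov[trunc μ T Y i, trunc μ T Y j; μ]| ≤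
      D.card * (p.covConst * ((1 + r) ^ (-(p.rate - b)) * S)) :=
    abs_sum_sum_le p.covConst_nonneg
      (fun i hi j hj => hY.abs_cov_trunc_trunc_le hT.le hi (Finset.mem_filter.1 hj).1)
      fun i hi => sum_rpow_neg_filter_not_dist_le hb'.le (hS i hi) hr
  have hsplit : ∑ i ∈ D, ∑ j ∈ D, cov[trunc μ T Y i, trunc μ T Y j; μ] =
      ∑ i ∈ D, ∑ j ∈ nbhd D r i, cov[trunc μ T Y i, trunc μ T Y j; μ] +
        ∑ i ∈ D, ∑ j ∈ D with ¬ dist i j ≤ r, cov[trunc μ T Y i, trunc μ T Y j; μ] := by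
    rw [← Finset.sum_add_distrib]
    exact Finset.sum_congr rfl fun i _ => (Finset.sum_filter_add_sum_filter_not _ _ _).symm
  simp only [Finset.sum_sub_distrib] at hnear
  rw [hvar, hY.integral_sum_mul_sum_trunc hT.le subset_rfl fun i _ => nbhd_subset D r i, mul_add]
  refine le_trans (le_of_eq ?_) ((abs_add_le _ _).trans (add_le_add hnear hfar))
  rw [hsplit]
  ring_nf

theorem integral_abs_sum_sub_sum_trunc_le (hY : WeakArray p μ Y D) (hT : 0 < T) (hb : 0 ≤ b)
    (hb' : b < p.rate) (hS : ∀ i ∈ D, ∑ j ∈ D, (1 + dist i j) ^ (-b) ≤ S) :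
    ∫ ω, |∑ i ∈ D, Y i ω - ∑ i ∈ D, trunc μ T Y i ω| ∂μ ≤ √(D.card * (p.tailConst b T * S)) := by
  have htail : ∀ i ∈ D, MemLp (fun ω => Y i ω - clip T (Y i ω)) 2 μ := fun i hi =>
    hY.memLp_comp hi (.sub_clip hT.le)
  set R : Ω → ℝ := fun ω => ∑ i ∈ D, (Y i ω - clip T (Y i ω)) with hR
  have hR₂ : MemLp R 2 μ := memLp_finsetSum D htail
  have hmean : ∫ ω, R ω ∂μ = -∑ i ∈ D, ∫ ω, clip T (Y i ω) ∂μ := by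
    rw [integral_finsetSum _ fun i hi => (htail i hi).integrable (by simp),
      ← Finset.sum_neg_distrib]
    refine Finset.sum_congr rfl fun i hi => ?_
    rw [integral_sub ((hY.memLp hi).integrable (by simp))
      ((hY.memLp_comp hi (.clip hT.le)).integrable (by simp)), hY.mean i hi, zero_sub]
  have hcentred : ∀ ω, |∑ i ∈ D, Y i ω - ∑ i ∈ D, trunc μ T Y i ω| =
      |∫ ω', R ω' ∂μ - R ω| := fun ω => by
    rw [hmean, ← abs_neg]
    simp only [hR, trunc, Finset.sum_sub_distrib]
    ring_nf
  simp_rw [hcentred]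
  refine (integral_abs_const_sub_le hR₂ _).trans ?_
  rw [sub_self, abs_zero, zero_add, ← covariance_self hR₂.aestronglyMeasurable.aemeasurable,
    covariance_fun_sum_fun_sum' htail htail]
  exact Real.sqrt_le_sqrt ((le_abs_self _).trans (abs_sum_sum_le (p.tailConst_nonneg b hT.le)
    (fun i hi j hj => hY.abs_cov_sub_clip_le hi hj hT (.sub_clip hT.le) hb hb') hS))

theorem abs_integral_comp_mul_trunc_le (hY : WeakArray p μ Y D) (hT : 0 ≤ T)
    (hL : LongRange μ Y D T r ℓ e) (hi : i ∈ D) {ψ : ℝ → ℝ} (hψ : ∀ x, |ψ x| ≤ 1)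
    (hψ' : ∀ x y, |ψ x - ψ y| ≤ |x - y|) {u : ℝ} (hu : |u| ≤ ℓ) :
    |∫ ω, ψ (u * (∑ j ∈ D, trunc μ T Y j ω - ∑ j ∈ nbhd D r i, trunc μ T Y j ω)) *
      trunc μ T Y i ω ∂μ| ≤ e := by
  set U := D.filter fun j => ¬ dist i j ≤ r
  have hUD : U ⊆ D := Finset.filter_subset _ _
  have hℓ : 0 ≤ ℓ := (abs_nonneg _).trans hu
  set f : (U → ℝ) → ℝ := fun x =>
    ψ (u * (∑ j, clip T (x j) - ∑ j ∈ U, ∫ ω, clip T (Y j ω) ∂μ)) with hf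
  have hfL : BddLip f 1 ℓ := by
    refine ⟨fun x => hψ _, hℓ, fun x y => (hψ' _ _).trans ?_⟩
    rw [← mul_sub, abs_mul, sub_sub_sub_cancel_right, ← Finset.sum_sub_distrib]
    exact mul_le_mul hu ((Finset.abs_sum_le_sum_abs _ _).trans (Finset.sum_le_sum fun k _ =>
      abs_sub_le_of_lipschitzWith_one (lipschitzWith_clip T) _ _)) (abs_nonneg _) hℓ
  have hfar : ∀ ω, ψ (u * (∑ j ∈ D, trunc μ T Y j ω - ∑ j ∈ nbhd D r i, trunc μ T Y j ω)) =
      f (restr Y U ω) := fun ω => by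
    rw [← Finset.sum_filter_add_sum_filter_not D fun j => dist i j ≤ r, nbhd, add_sub_cancel_left]
    simp only [hf, trunc, Finset.sum_sub_distrib, restr]
    rw [Finset.sum_coe_sort U fun j => clip T (Y j ω)]
  have hfm : Measurable fun ω => f (restr Y U ω) :=
    hfL.continuous.measurable.comp (measurable_pi_lambda _ fun j => hY.measurable j (hUD j.2))
  have hcov := hL i hi U hUD (fun j hj => by
    rw [dist_comm]
    exact (not_le.1 (Finset.mem_filter.1 hj).2).le) f hfL
  rw [covariance_comm, ← hY.cov_trunc_left hT hi, hY.cov_trunc_eq_integral hT hi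
    (.of_bound hfm.aestronglyMeasurable 1 (.of_forall fun ω => hfL.abs_le _))] at hcov
  simpa only [hfar, mul_comm] using hcov

theorem norm_integral_trunc_mul_exp_le (hY : WeakArray p μ Y D) (hT : 0 ≤ T)
    (hL : LongRange μ Y D T r ℓ e) (hi : i ∈ D) {u : ℝ} (hu : |u| ≤ ℓ) :
    ‖∫ ω, (trunc μ T Y i ω : ℂ) * Complex.exp ((u *
      (∑ j ∈ D, trunc μ T Y j ω - ∑ j ∈ nbhd D r i, trunc μ T Y j ω) : ℝ) * Complex.I) ∂μ‖ ≤
      2 * e := by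
  have hmeas : Measurable fun ω =>
      u * (∑ j ∈ D, trunc μ T Y j ω - ∑ j ∈ nbhd D r i, trunc μ T Y j ω) :=
    ((Finset.measurable_fun_sum D fun j hj => hY.measurable_trunc hj).sub
      (Finset.measurable_fun_sum _ fun j hj =>
        hY.measurable_trunc (nbhd_subset D r i hj))).const_mul _
  refine (norm_integral_ofReal_mul_exp_le ((hY.memLp_trunc hT hi 1).integrable le_rfl)
    hmeas.aemeasurable).trans ?_
  rw [two_mul]
  exact add_le_add
    (hY.abs_integral_comp_mul_trunc_le hT hL hi Real.abs_cos_le_one Real.abs_cos_sub_cos_le hu)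
    (hY.abs_integral_comp_mul_trunc_le hT hL hi Real.abs_sin_le_one Real.abs_sin_sub_sin_le hu)

theorem integral_abs_one_sub_le (hY : WeakArray p μ Y D) (hD : D.Nonempty) (hT : 0 < T)
    (hr : 0 ≤ r) (hb : 0 ≤ b) (hb' : b < p.rate)
    (hS : ∀ i ∈ D, ∑ j ∈ D, (1 + dist i j) ^ (-b) ≤ S)
    (hG : ∀ i ∈ D, ((nbhd D (3 * r) i).card : ℝ) ≤ G) (hσ : 0 < σ)
    (hσY : σ ^ 2 = Var[fun ω => ∑ i ∈ D, Y i ω; μ]) (hσw : σ⁻¹ ≤ w / √D.card) :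
    ∫ ω, |1 - (σ ^ 2)⁻¹ * ∑ i ∈ D, trunc μ T Y i ω * ∑ j ∈ nbhd D r i, trunc μ T Y j ω| ∂μ ≤
      w ^ 2 * (2 * p.tailConst b T * S + p.covConst * ((1 + r) ^ (-(p.rate - b)) * S)) +
        w ^ 2 * √(p.pairConst T * 3 ^ p.α * (3 * S)) * (G / √D.card) := by
  obtain ⟨i₀, hi₀⟩ := hD
  have hS₀ : 0 ≤ S := (Finset.sum_nonneg fun j _ => by positivity).trans (hS i₀ hi₀)
  have hG₀ : 0 ≤ G := (Nat.cast_nonneg _).trans (hG i₀ hi₀)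
  have hcard : (0 : ℝ) < D.card := by exact_mod_cast Finset.card_pos.2 ⟨i₀, hi₀⟩
  have := p.covConst_nonneg
  have := p.tailConst_nonneg b hT.le
  have hpair₀ := p.pairConst_nonneg hT.le
  have hσ2 : (σ ^ 2)⁻¹ ≤ w ^ 2 / D.card := by
    rw [← inv_pow, ← Real.sq_sqrt hcard.le, ← div_pow]
    gcongr
  have hQ : MemLp (fun ω => ∑ i ∈ D, trunc μ T Y i ω * ∑ j ∈ nbhd D r i, trunc μ T Y j ω) 2 μ :=
    memLp_finsetSum D fun i hi => (memLp_finsetSum _ fun j hj =>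
      hY.memLp_trunc hT.le (nbhd_subset D r i hj) ∞).mul (hY.memLp_trunc hT.le hi 2)
  refine (integral_abs_const_sub_le (hQ.const_mul (σ ^ 2)⁻¹) 1).trans (add_le_add ?_ ?_)
  · have hfactor (x : ℝ) : 1 - (σ ^ 2)⁻¹ * x = (σ ^ 2)⁻¹ * (σ ^ 2 - x) := by field_simp
    rw [integral_const_mul, hfactor, abs_mul, abs_of_pos (by positivity), hσY]
    calc _ ≤ w ^ 2 / D.card * (D.card * (2 * p.tailConst b T * S +
          p.covConst * ((1 + r) ^ (-(p.rate - b)) * S))) :=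
          mul_le_mul (hσY ▸ hσ2) (hY.abs_variance_sub_integral_le hT hr hb hb' hS)
            (abs_nonneg _) (by positivity)
      _ = _ := by field_simp
  · rw [variance_const_mul, Real.sqrt_mul (by positivity), Real.sqrt_sq (by positivity)]
    have hvar := hY.variance_sum_trunc_mul_le hT.le hr (fun i hi =>
      sum_rpow_neg_le_of_le (hb'.le.trans p.rate_le) (hS i hi)) hG
    calc _ ≤ w ^ 2 / D.card * √(p.pairConst T * 3 ^ p.α * (3 * S) * (√D.card * G) ^ 2) := by
          gcongr
          rw [mul_pow, Real.sq_sqrt hcard.le]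
          linarith
      _ = w ^ 2 / √D.card ^ 2 * (√(p.pairConst T * 3 ^ p.α * (3 * S)) * (√D.card * G)) := by
          rw [Real.sqrt_mul (by positivity), Real.sqrt_sq (by positivity), Real.sq_sqrt hcard.le]
      _ = _ := by field_simp

theorem sum_integral_sum_trunc_sq_le (hY : WeakArray p μ Y D) (hT : 0 ≤ T) (hr : 0 ≤ r)
    (hS : ∀ i ∈ D, ∑ j ∈ D, (1 + dist i j) ^ (-p.rate) ≤ S)
    (hG : ∀ i ∈ D, ((nbhd D (3 * r) i).card : ℝ) ≤ G) :
    ∑ i ∈ D, ∫ ω, (∑ j ∈ nbhd D r i, trunc μ T Y j ω) ^ 2 ∂μ ≤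
      D.card * (G * (p.covConst * S)) := by
  rw [← nsmul_eq_mul]
  refine Finset.sum_le_card_nsmul _ _ _ fun i hi => ?_
  refine (hY.integral_sum_trunc_sq_le hT hS (nbhd_subset D r i)).trans ?_
  have hS₀ : 0 ≤ S := (Finset.sum_nonneg fun j _ => by positivity).trans (hS i hi)
  have hcard : ((nbhd D r i).card : ℝ) ≤ (nbhd D (3 * r) i).card := by
    exact_mod_cast Finset.card_le_card (nbhd_mono D (by linarith) i)
  exact mul_le_mul_of_nonneg_right (hcard.trans (hG i hi)) (mul_nonneg p.covConst_nonneg hS₀)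

theorem norm_deriv_charFun_trunc_add_le (hY : WeakArray p μ Y D) (hD : D.Nonempty) (hT : 0 < T)
    (hr : 0 ≤ r) (hb : 0 ≤ b) (hb' : b < p.rate)
    (hS : ∀ i ∈ D, ∑ j ∈ D, (1 + dist i j) ^ (-b) ≤ S)
    (hG : ∀ i ∈ D, ((nbhd D (3 * r) i).card : ℝ) ≤ G) (hσ : 0 < σ)
    (hσY : σ ^ 2 = Var[fun ω => ∑ i ∈ D, Y i ω; μ]) (hσw : σ⁻¹ ≤ w / √D.card)
    (hL : LongRange μ Y D T r ℓ e) (ht : |t| * (w / √D.card) ≤ ℓ) :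
    ‖deriv (charFun (μ.map fun ω => σ⁻¹ * ∑ i ∈ D, trunc μ T Y i ω)) t +
        t * charFun (μ.map fun ω => σ⁻¹ * ∑ i ∈ D, trunc μ T Y i ω) t‖ ≤
      2 * w * (√D.card * e) +
      (|t| * (w ^ 2 * (2 * p.tailConst b T * S + p.covConst * ((1 + r) ^ (-(p.rate - b)) * S)) +
        w ^ 2 * √(p.pairConst T * 3 ^ p.α * (3 * S)) * (G / √D.card)) +
      4 * T * w ^ 3 * (p.covConst * S) * |t| ^ 2 * (G / √D.card)) := by
  have hcard : (0 : ℝ) < D.card := by exact_mod_cast Finset.card_pos.2 hD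
  have hsqrt : √(D.card : ℝ) * √D.card = D.card := Real.mul_self_sqrt hcard.le
  have hw : 0 ≤ w / √D.card := (inv_pos.2 hσ).le.trans hσw
  have hu : |t * σ⁻¹| ≤ ℓ := by
    rw [abs_mul, abs_of_pos (inv_pos.2 hσ)]
    exact (mul_le_mul_of_nonneg_left hσw (abs_nonneg t)).trans ht
  have hfar : ∑ i ∈ D, ‖∫ ω, (trunc μ T Y i ω : ℂ) * Complex.exp ((t * σ⁻¹ *
      (∑ j ∈ D, trunc μ T Y j ω - ∑ j ∈ nbhd D r i, trunc μ T Y j ω) : ℝ) * Complex.I) ∂μ‖ ≤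
      D.card * (2 * e) := by
    rw [← nsmul_eq_mul]
    exact Finset.sum_le_card_nsmul _ _ _ fun i hi =>
      hY.norm_integral_trunc_mul_exp_le hT.le hL hi hu
  refine (norm_deriv_charFun_add_le (fun i hi => hY.memLp_trunc hT.le hi 2)
    (fun i _ => abs_trunc_le hT.le i) (fun i _ => memLp_finsetSum _ fun j hj =>
      hY.memLp_trunc hT.le (nbhd_subset D r i hj) 2) hσ t).trans
    (add_le_add ?_ (add_le_add ?_ ?_))
  · refine (mul_le_mul hσw hfar (Finset.sum_nonneg fun _ _ => norm_nonneg _)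
      hw).trans (le_of_eq ?_)
    nth_rw 2 [← hsqrt]
    field_simp
  · exact mul_le_mul_of_nonneg_left
      (hY.integral_abs_one_sub_le hD hT hr hb hb' hS hG hσ hσY hσw) (abs_nonneg t)
  · have hsum := hY.sum_integral_sum_trunc_sq_le hT.le hr
      (fun i hi => sum_rpow_neg_le_of_le hb'.le (hS i hi)) hG
    calc _ ≤ 2 * (w / √D.card) ^ 3 * (2 * T) * t ^ 2 * (D.card * (G * (p.covConst * S))) := by
          rw [← inv_pow]
          gcongr
      _ = _ := by
          nth_rw 2 [← hsqrt]
          rw [sq_abs]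
          field_simp
          ring

theorem norm_charFun_sub_charFun_trunc_le (hY : WeakArray p μ Y D) (hD : D.Nonempty) (hT : 0 < T)
    (hb : 0 ≤ b) (hb' : b < p.rate) (hS : ∀ i ∈ D, ∑ j ∈ D, (1 + dist i j) ^ (-b) ≤ S)
    (hσ : 0 < σ) (hσw : σ⁻¹ ≤ w / √D.card) :
    ‖charFun (μ.map fun ω => σ⁻¹ * ∑ i ∈ D, Y i ω) t -
        charFun (μ.map fun ω => σ⁻¹ * ∑ i ∈ D, trunc μ T Y i ω) t‖ ≤
      |t| * (w * √(p.tailConst b T * S)) := by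
  have hcard : (0 : ℝ) < D.card := by exact_mod_cast Finset.card_pos.2 hD
  have hw : 0 ≤ w / √D.card := (inv_pos.2 hσ).le.trans hσw
  refine (norm_charFun_map_sub_charFun_map_le
    ((integrable_finsetSum _ fun i hi => (hY.memLp hi).integrable (by simp)).const_mul _)
    ((integrable_finsetSum _ fun i hi => (hY.memLp_trunc hT.le hi 1).integrable le_rfl).const_mul _)
    t).trans (mul_le_mul_of_nonneg_left ?_ (abs_nonneg t))
  simp only [← mul_sub, abs_mul, abs_of_pos (inv_pos.2 hσ)]
  rw [integral_const_mul]
  calc _ ≤ w / √D.card * √(D.card * (p.tailConst b T * S)) := by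
        gcongr
        exact hY.integral_abs_sum_sub_sum_trunc_le hT hb hb' hS
    _ = _ := by
        rw [Real.sqrt_mul hcard.le]
        field_simp

end WeakArray

/-- The part of the distance to the Gaussian characteristic function at `t` that is due to the
truncation at level `T`; it vanishes as `T → ∞` uniformly in the number of variables. -/
def ArrayParams.truncError (p : ArrayParams) (b S w t T : ℝ) : ℝ :=
  |t| * (|t| * (w ^ 2 * (2 * p.tailConst b T * S))) + |t| * (w * √(p.tailConst b T * S))

/-- The part of the distance to the Gaussian characteristic function at `t` that vanishes, for a
fixed truncation level `T`, as the number `x` of variables tends to infinity. Here `r` is the radius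
of the neighbourhoods and `e` bounds the long-range covariances. -/
def ArrayParams.blockError (p : ArrayParams) (b S w t T x r e : ℝ) : ℝ :=
  |t| * (2 * w * (√x * e) +
    (|t| * (w ^ 2 * (p.covConst * ((1 + r) ^ (-(p.rate - b)) * S)) +
        w ^ 2 * √(p.pairConst T * 3 ^ p.α * (3 * S)) * (S * (1 + 3 * r) ^ b / √x)) +
      4 * T * w ^ 3 * (p.covConst * S) * |t| ^ 2 * (S * (1 + 3 * r) ^ b / √x)))

theorem ArrayParams.tendsto_truncError (p : ArrayParams) {b : ℝ} (hb : b < p.rate) (S w t : ℝ) :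
    Tendsto (p.truncError b S w t) atTop (𝓝 0) := by
  have h := p.tendsto_tailConst hb
  have hvar := ((((h.const_mul 2).mul_const S).const_mul (w ^ 2)).const_mul |t|).const_mul |t|
  have hL1 := ((h.mul_const S).sqrt.const_mul w).const_mul |t|
  have hlim := hvar.add hL1
  simp only [mul_zero, zero_mul, Real.sqrt_zero, add_zero] at hlim
  exact hlim

theorem WeakArray.norm_charFun_sub_exp_le {E Ω : Type*} [PseudoMetricSpace E] [MeasurableSpace Ω]
    {p : ArrayParams} {μ : Measure Ω} [IsProbabilityMeasure μ] {Y : E → Ω → ℝ} {D : Finset E}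
    {T r b S e σ w t : ℝ} (hY : WeakArray p μ Y D) (hD : D.Nonempty) (hT : 0 < T)
    (hr : 0 ≤ r) (hb : 0 ≤ b) (hb' : b < p.rate)
    (hS : ∀ i ∈ D, ∑ j ∈ D, (1 + dist i j) ^ (-b) ≤ S) (hσ : 0 < σ)
    (hσY : σ ^ 2 = Var[fun ω => ∑ i ∈ D, Y i ω; μ]) (hw : 0 ≤ w) (hσw : σ⁻¹ ≤ w / √D.card)
    (hL : LongRange μ Y D T r (|t| * w / √D.card) e) :
    ‖charFun (μ.map fun ω => σ⁻¹ * ∑ i ∈ D, Y i ω) t - Complex.exp (-(t : ℂ) ^ 2 / 2)‖ ≤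
      p.truncError b S w t T + p.blockError b S w t T D.card r e := by
  obtain ⟨i₀, hi₀⟩ := hD
  have hS₀ : 0 ≤ S := (Finset.sum_nonneg fun j _ => by positivity).trans (hS i₀ hi₀)
  have hcov₀ := p.covConst_nonneg
  have htail₀ := p.tailConst_nonneg b hT.le
  have hG : ∀ i ∈ D, ((nbhd D (3 * r) i).card : ℝ) ≤ S * (1 + 3 * r) ^ b := fun i hi =>
    card_filter_dist_le hb (hS i hi) (by positivity)
  have hint : Integrable (fun ω => σ⁻¹ * ∑ i ∈ D, trunc μ T Y i ω) μ :=
    (integrable_finsetSum _ fun i hi => (hY.memLp_trunc hT.le hi 1).integrable le_rfl).const_mul _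
  have htrunc := norm_sub_exp_le_of_norm_deriv_add_le (t := t) (differentiable_charFun_map hint)
    (by simp [charFun_map hint.aemeasurable])
    (ε := 2 * w * (√D.card * e) + (|t| * (w ^ 2 * (2 * p.tailConst b T * S +
      p.covConst * ((1 + r) ^ (-(p.rate - b)) * S)) +
      w ^ 2 * √(p.pairConst T * 3 ^ p.α * (3 * S)) * (S * (1 + 3 * r) ^ b / √D.card)) +
      4 * T * w ^ 3 * (p.covConst * S) * |t| ^ 2 * (S * (1 + 3 * r) ^ b / √D.card)))
    fun s hs => (hY.norm_deriv_charFun_trunc_add_le ⟨i₀, hi₀⟩ hT hr hb hb' hS hG hσ hσY hσw hL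
      (t := s) (by rw [mul_div_assoc]; gcongr)).trans (by gcongr)
  refine (norm_sub_le_norm_sub_add_norm_sub _ _ _).trans ((add_le_add
    (hY.norm_charFun_sub_charFun_trunc_le ⟨i₀, hi₀⟩ hT hb hb' hS hσ hσw) htrunc).trans
    (le_of_eq ?_))
  unfold ArrayParams.truncError ArrayParams.blockError
  ring

theorem tendsto_one_add_mul_rpow_div_sqrt {x : ℕ → ℝ} (hx : Tendsto x atTop atTop) {γ b k : ℝ}
    (hγ : 0 ≤ γ) (hb : 0 ≤ b) (hγb : γ * b < 1 / 2) (hk : 0 ≤ k) :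
    Tendsto (fun n => (1 + k * x n ^ γ) ^ b / √(x n)) atTop (𝓝 0) := by
  have hlim := ((tendsto_rpow_neg_atTop (sub_pos.2 hγb)).comp hx).const_mul ((1 + k) ^ b)
  rw [mul_zero] at hlim
  refine squeeze_zero' ?_ ?_ hlim <;> filter_upwards [hx.eventually_ge_atTop 1] with n hn
  · positivity
  · have hx₀ : 0 < x n := by linarith
    have hbase : 1 + k * x n ^ γ ≤ (1 + k) * x n ^ γ := by
      linarith [Real.one_le_rpow hn hγ]
    calc (1 + k * x n ^ γ) ^ b / √(x n) ≤ ((1 + k) * x n ^ γ) ^ b / √(x n) := by gcongr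
      _ = (1 + k) ^ b * x n ^ (-(1 / 2 - γ * b)) := by
        rw [Real.mul_rpow (by positivity) (by positivity), ← Real.rpow_mul hx₀.le,
          Real.sqrt_eq_rpow, mul_div_assoc, ← Real.rpow_sub hx₀, neg_sub]

theorem ArrayParams.tendsto_blockError (p : ArrayParams) {b γ : ℝ} {x e : ℕ → ℝ} (hb : 0 ≤ b)
    (hb' : b < p.rate) (hγ : 0 < γ) (hγb : γ * b < 1 / 2) (hx : Tendsto x atTop atTop)
    (he : Tendsto (fun n => √(x n) * e n) atTop (𝓝 0)) (S w t T : ℝ) :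
    Tendsto (fun n => p.blockError b S w t T (x n) (x n ^ γ) (e n)) atTop (𝓝 0) := by
  have hcard : Tendsto (fun n => S * (1 + 3 * x n ^ γ) ^ b / √(x n)) atTop (𝓝 0) := by
    simpa [mul_div_assoc] using
      (tendsto_one_add_mul_rpow_div_sqrt hx hγ.le hb hγb zero_le_three).const_mul S
  have hfar : Tendsto (fun n => (1 + x n ^ γ) ^ (-(p.rate - b))) atTop (𝓝 0) :=
    (tendsto_rpow_neg_atTop (sub_pos.2 hb')).comp
      (tendsto_atTop_add_const_left _ 1 ((tendsto_rpow_atTop hγ).comp hx))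
  have hlim := (((he.const_mul (2 * w)).add
    ((((((hfar.mul_const S).const_mul p.covConst).const_mul (w ^ 2)).add
      (hcard.const_mul (w ^ 2 * √(p.pairConst T * 3 ^ p.α * (3 * S))))).const_mul |t|).add
    (hcard.const_mul (4 * T * w ^ 3 * (p.covConst * S) * |t| ^ 2)))).const_mul |t|)
  simp only [zero_mul, mul_zero, add_zero] at hlim
  exact hlim

theorem tendsto_zero_of_le_add {u : ℕ → ℝ} {F : ℝ → ℝ} (hu : ∀ n, 0 ≤ u n)
    (hF : Tendsto F atTop (𝓝 0))
    (h : ∀ T, 0 < T → ∃ η : ℕ → ℝ, Tendsto η atTop (𝓝 0) ∧ ∀ᶠ n in atTop, u n ≤ F T + η n) :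
    Tendsto u atTop (𝓝 0) := by
  refine tendsto_order.2 ⟨fun ε hε => .of_forall fun n => hε.trans_le (hu n), fun ε hε => ?_⟩
  obtain ⟨T, hFT, hT⟩ := ((hF.eventually (gt_mem_nhds (half_pos hε))).and
    (eventually_gt_atTop 0)).exists
  obtain ⟨η, hη, hle⟩ := h T hT
  filter_upwards [hle, hη.eventually (gt_mem_nhds (half_pos hε))] with n hun hηn
  linarith

theorem tendsto_charFun_of_weakArray {E : Type*} [PseudoMetricSpace E] {D : ℕ → Finset E}
    (hD : Tendsto (fun n => (D n).card) atTop atTop) {Ω : ℕ → Type*} [∀ n, MeasurableSpace (Ω n)]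
    {μ : ∀ n, Measure (Ω n)} [∀ n, IsProbabilityMeasure (μ n)] {Y : ∀ n, E → Ω n → ℝ}
    {p : ArrayParams} (hY : ∀ᶠ n in atTop, WeakArray p (μ n) (Y n) (D n)) {b S γ c₀ : ℝ}
    (hb : 0 ≤ b) (hb' : b < p.rate)
    (hS : ∀ n, ∀ i ∈ D n, ∑ j ∈ D n, (1 + dist i j) ^ (-b) ≤ S) (hc₀ : 0 < c₀)
    (hvar : ∀ᶠ n in atTop, c₀ * (D n).card ≤ Var[fun ω => ∑ i ∈ D n, Y n i ω; μ n])
    (hγ : 0 < γ) (hγb : γ * b < 1 / 2)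
    (hlong : ∀ T > 0, ∀ Λ ≥ 0, ∃ e : ℕ → ℝ, Tendsto (fun n => √(D n).card * e n) atTop (𝓝 0) ∧
      ∀ᶠ n in atTop, LongRange (μ n) (Y n) (D n) T ((D n).card ^ γ) (Λ / √(D n).card) (e n))
    (t : ℝ) :
    Tendsto (fun n => charFun ((μ n).map fun ω =>
      (√Var[fun ω => ∑ i ∈ D n, Y n i ω; μ n])⁻¹ * ∑ i ∈ D n, Y n i ω) t) atTop
      (𝓝 (Complex.exp (-(t : ℂ) ^ 2 / 2))) := by
  rw [tendsto_iff_norm_sub_tendsto_zero]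
  refine tendsto_zero_of_le_add (fun n => norm_nonneg _)
    (p.tendsto_truncError hb' S (√c₀)⁻¹ t) fun T hT => ?_
  obtain ⟨e, he, hL⟩ := hlong T hT (|t| * (√c₀)⁻¹) (by positivity)
  have hcard : Tendsto (fun n => ((D n).card : ℝ)) atTop atTop :=
    tendsto_natCast_atTop_atTop.comp hD
  refine ⟨_, p.tendsto_blockError hb hb' hγ hγb hcard he S (√c₀)⁻¹ t T, ?_⟩
  filter_upwards [hY, hvar, hL, hD.eventually_gt_atTop 0] with n hYn hvn hLn hn
  have hcn : 0 < c₀ * (D n).card := mul_pos hc₀ (Nat.cast_pos.2 hn)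
  refine hYn.norm_charFun_sub_exp_le (Finset.card_pos.1 hn) hT (by positivity) hb hb' (hS n)
    (Real.sqrt_pos.2 (hcn.trans_le hvn)) (Real.sq_sqrt (variance_nonneg _ _)) (by positivity) ?_ hLn
  rw [div_eq_mul_inv, ← mul_inv, ← Real.sqrt_mul hc₀.le]
  exact inv_anti₀ (Real.sqrt_pos.2 hcn) (Real.sqrt_le_sqrt hvn)

section coefficients

variable {ι : Type*} [Fintype ι] {E Ω : Type*} [MeasurableSpace Ω] {μ : Measure Ω}
  {X : E → Ω → ℝ} {pair : Finset E → Finset E → ℝ≥0∞}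

theorem BddLip.lip_le_ofReal {f : (ι → ℝ) → ℝ} {A L : ℝ} (hf : BddLip f A L) :
    lip f ≤ ENNReal.ofReal L := by
  refine iSup_le fun x => iSup_le fun y => iSup_le fun hxy => ENNReal.ofReal_le_ofReal ?_
  obtain ⟨k, hk⟩ := Function.ne_iff.1 hxy
  exact (div_le_iff₀ (Finset.sum_pos' (fun _ _ => abs_nonneg _)
    ⟨k, Finset.mem_univ k, abs_pos.2 (sub_ne_zero.2 hk)⟩)).2 (hf.abs_sub_le x y)

theorem BddLip.supNorm_le_ofReal {U : Finset E} {f : (U → ℝ) → ℝ} {A L : ℝ} (hf : BddLip f A L) :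
    supNorm μ (fun ω => f (restr X U ω)) ≤ ENNReal.ofReal A :=
  sInf_le (Set.mem_ofPred.2 (.of_forall fun _ => ENNReal.ofReal_le_ofReal (hf.abs_le _)))

theorem abs_le_of_ofReal_div_le {x τ y : ℝ} {z : ℝ≥0∞} (hτ : 0 ≤ τ) (hy : 0 ≤ y)
    (hz : z ≤ ENNReal.ofReal y) (h : ENNReal.ofReal |x| / z ≤ ENNReal.ofReal τ) :
    |x| ≤ τ * y := by
  rw [ENNReal.div_le_iff_le_mul (.inr ENNReal.ofReal_ne_top)
    (.inl (hz.trans_lt ENNReal.ofReal_lt_top).ne)] at h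
  have hmul := h.trans (mul_le_mul_right hz _)
  rw [← ENNReal.ofReal_mul hτ] at hmul
  exact (ENNReal.ofReal_le_ofReal_iff (mul_nonneg hτ hy)).1 hmul

/-- The dependence coefficient `pair` controls the covariances of bounded Lipschitz functions, up to
the constant `κ`. The weight `w` of the term with the Lipschitz constant of the first function is
`0` for `θ`-dependence and `1` for `η`-dependence. -/
def CovControlled (μ : Measure Ω) (X : E → Ω → ℝ) (pair : Finset E → Finset E → ℝ≥0∞)
    (κ w : ℝ) : Prop :=
  ∀ (U V : Finset E) (τ : ℝ), 0 ≤ τ → pair U V ≤ ENNReal.ofReal τ →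
    ∀ (f : (U → ℝ) → ℝ) (g : (V → ℝ) → ℝ) (A A' L L' : ℝ), BddLip f A L → BddLip g A' L' →
    |cov[fun ω => f (restr X U ω), fun ω => g (restr X V ω); μ]| ≤
      κ * τ * (w * (U.card * A' * L) + V.card * A * L')

theorem covControlled_thetaPair (μ : Measure Ω) (X : E → Ω → ℝ) :
    CovControlled μ X (thetaPair μ X) 1 0 := by
  intro U V τ hτ h f g A A' L L' hf hg
  have hA := hf.nonneg
  have hL' := hg.lip_nonneg
  have hle : _ ≤ thetaPair μ X U V := le_iSup₂_of_le f g (le_iSup_of_le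
    ⟨hf.continuous.measurable, hf.supNorm_le_ofReal.trans_lt ENNReal.ofReal_lt_top,
      hg.lip_le_ofReal.trans_lt ENNReal.ofReal_lt_top⟩ le_rfl)
  rw [one_mul, zero_mul, zero_add]
  refine abs_le_of_ofReal_div_le hτ (by positivity) ?_ (hle.trans h)
  rw [ENNReal.ofReal_mul (by positivity), ENNReal.ofReal_mul (by positivity),
    ENNReal.ofReal_natCast]
  gcongr
  exacts [hf.supNorm_le_ofReal, hg.lip_le_ofReal]

theorem covControlled_etaPair (μ : Measure Ω) (X : E → Ω → ℝ) :
    CovControlled μ X (etaPair μ X) 1 1 := by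
  intro U V τ hτ h f g A A' L L' hf hg
  have hA := hf.nonneg
  have hA' := hg.nonneg
  have hL := hf.lip_nonneg
  have hL' := hg.lip_nonneg
  have hle : _ ≤ etaPair μ X U V := le_iSup₂_of_le f g (le_iSup_of_le
    ⟨⟨hf.supNorm_le_ofReal.trans_lt ENNReal.ofReal_lt_top,
      hf.lip_le_ofReal.trans_lt ENNReal.ofReal_lt_top⟩,
      hg.supNorm_le_ofReal.trans_lt ENNReal.ofReal_lt_top,
      hg.lip_le_ofReal.trans_lt ENNReal.ofReal_lt_top⟩ le_rfl)
  rw [one_mul, one_mul]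
  refine abs_le_of_ofReal_div_le hτ (by positivity) ?_ (hle.trans h)
  rw [ENNReal.ofReal_add (by positivity) (by positivity), ENNReal.ofReal_mul (by positivity),
    ENNReal.ofReal_mul (by positivity), ENNReal.ofReal_mul (by positivity),
    ENNReal.ofReal_mul (by positivity), ENNReal.ofReal_natCast, ENNReal.ofReal_natCast]
  gcongr
  exacts [hg.supNorm_le_ofReal, hf.lip_le_ofReal, hf.supNorm_le_ofReal, hg.lip_le_ofReal]

theorem CovControlled.const_mul {κ w r r₀ : ℝ} (h : CovControlled μ X pair κ w) (hκ : 0 ≤ κ)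
    (hw : 0 ≤ w) (hr : 0 ≤ r) (hr₀ : r ≤ r₀) :
    CovControlled μ (fun i ω => r * X i ω) pair (κ * r₀) w := by
  intro U V τ hτ hτ' f g A A' L L' hf hg
  have hA := hf.nonneg
  have hA' := hg.nonneg
  have hL := hf.lip_nonneg
  have hL' := hg.lip_nonneg
  calc _ ≤ κ * τ * (w * (U.card * A' * (L * r)) + V.card * A * (L' * r)) :=
        h U V τ hτ hτ' _ _ A A' _ _ (hf.comp_mul hr) (hg.comp_mul hr)
    _ = κ * r * τ * (w * (U.card * A' * L) + V.card * A * L') := by ring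
    _ ≤ _ := by gcongr

theorem CovControlled.longRange [PseudoMetricSpace E] {D : Finset E} {κ w C β T r ℓ : ℝ}
    (h : CovControlled μ X pair κ w) (hκ : 0 ≤ κ) (hw : 0 ≤ w) (hC : 0 ≤ C) (hT : 0 ≤ T)
    (hr : 0 ≤ r) (hpair : ∀ i ∈ D, ∀ U ⊆ D, (∀ j ∈ U, r ≤ dist j i) →
      pair U {i} ≤ ENNReal.ofReal (C * r ^ (-β))) :
    LongRange μ X D T r ℓ (κ * (C * r ^ (-β)) * (w * (D.card * T * ℓ) + 1)) := by
  intro i hi U hU hdist f hf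
  have hℓ := hf.lip_nonneg
  have hg : BddLip (fun x : ({i} : Finset E) → ℝ => clip T (x ⟨i, Finset.mem_singleton_self i⟩))
      T 1 := .comp_eval (abs_clip_le hT) (lipschitzWith_clip T) _
  refine (h U {i} _ (by positivity) (hpair i hi U hU hdist) f _ 1 T ℓ 1 hf hg).trans ?_
  rw [Finset.card_singleton, Nat.cast_one, one_mul, one_mul]
  gcongr

end coefficients

section decay

theorem isBigOPow_finset_sup {ι : Type*} {ε : ι → ℝ → ℝ≥0∞} {a : ℝ} {P : Finset ι}
    (h : ∀ p ∈ P, IsBigOPow (ε p) a) : IsBigOPow (fun s => P.sup fun p => ε p s) a := by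
  choose! C hC using h
  refine ⟨P.sup C, ?_⟩
  filter_upwards [(Finset.eventually_all P).2 hC] with s hs
  refine Finset.sup_le fun p hp => (hs p hp).trans ?_
  gcongr
  exact Finset.le_sup hp

theorem IsBigOPow.exists_le_ofReal {ε : ℝ → ℝ≥0∞} {a : ℝ} (h : IsBigOPow ε a) :
    ∃ C s₀ : ℝ, 0 ≤ C ∧ 1 ≤ s₀ ∧ ∀ s, s₀ ≤ s → ε s ≤ ENNReal.ofReal (C * s ^ (-a)) := by
  obtain ⟨C, hC⟩ := h
  obtain ⟨s₁, hs₁⟩ := eventually_atTop.1 hC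
  refine ⟨C, max 1 s₁, C.2, le_max_left _ _, fun s hs => ?_⟩
  rw [ENNReal.ofReal_mul C.coe_nonneg, ENNReal.ofReal_coe_nnreal]
  exact hs₁ s ((le_max_right _ _).trans hs)

variable {E : Type*} [PseudoMetricSpace E] {D : ℕ → Finset E}
  {pair : ℕ → Finset E → Finset E → ℝ≥0∞}

theorem le_unifCoeff {n : ℕ} {U V : Finset E} {s : ℝ} (hU : U ⊆ D n) (hV : V ⊆ D n)
    (hs : ∀ i ∈ U, ∀ j ∈ V, s ≤ dist i j) :
    pair n U V ≤ unifCoeff D pair U.card V.card s :=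
  le_iSup_of_le n (le_iSup₂_of_le U V (le_iSup_of_le ⟨hU, hV, rfl, rfl, hs⟩ le_rfl))

theorem exists_pair_le_of_card_add_card_le {α : ℝ}
    (h : ∀ u v : ℕ, u + v ≤ 4 → IsBigOPow (unifCoeff D pair u v) α) :
    ∃ C s₀ : ℝ, 0 ≤ C ∧ 1 ≤ s₀ ∧ ∀ n, ∀ U ⊆ D n, ∀ V ⊆ D n, U.card + V.card ≤ 4 →
      ∀ s, s₀ ≤ s → (∀ i ∈ U, ∀ j ∈ V, s ≤ dist i j) →
      pair n U V ≤ ENNReal.ofReal (C * s ^ (-α)) := by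
  obtain ⟨P, hP⟩ : ∃ P : Finset (ℕ × ℕ), ∀ q, q ∈ P ↔ q.1 + q.2 ≤ 4 :=
    ⟨((Finset.range 5) ×ˢ (Finset.range 5)).filter fun q => q.1 + q.2 ≤ 4, fun q => by
      simp only [Finset.mem_filter, Finset.mem_product, Finset.mem_range]; omega⟩
  have hsup : IsBigOPow (fun s => P.sup fun q => unifCoeff D pair q.1 q.2 s) α :=
    isBigOPow_finset_sup fun q hq => h _ _ ((hP q).1 hq)
  obtain ⟨C, s₀, hC, hs₀, hle⟩ := hsup.exists_le_ofReal
  refine ⟨C, s₀, hC, hs₀, fun n U hU V hV hUV s hs hd =>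
    (le_unifCoeff hU hV hd).trans (le_trans ?_ (hle s hs))⟩
  have hmem : (U.card, V.card) ∈ P := (hP _).2 hUV
  exact Finset.le_sup_of_le hmem le_rfl

theorem exists_pair_singleton_le {β : ℝ}
    (h : IsBigOPow (fun s => ⨆ u : ℕ, unifCoeff D pair u 1 s) β) :
    ∃ C s₀ : ℝ, 0 ≤ C ∧ 1 ≤ s₀ ∧ ∀ s, s₀ ≤ s → ∀ n, ∀ i ∈ D n, ∀ U ⊆ D n,
      (∀ j ∈ U, s ≤ dist j i) → pair n U {i} ≤ ENNReal.ofReal (C * s ^ (-β)) := by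
  obtain ⟨C, s₀, hC, hs₀, hle⟩ := h.exists_le_ofReal
  refine ⟨C, s₀, hC, hs₀, fun s hs n i hi U hU hd => le_trans ?_ (hle s hs)⟩
  refine (le_unifCoeff hU (Finset.singleton_subset_iff.2 hi) (s := s) (by simpa using hd)).trans ?_
  rw [Finset.card_singleton]
  exact le_iSup (fun u => unifCoeff D pair u 1 s) U.card

variable {Ω : ℕ → Type*} [∀ n, MeasurableSpace (Ω n)] {μ : ∀ n, Measure (Ω n)}
  {Y : ∀ n, E → Ω n → ℝ} {m K α β κ w γ : ℝ} {d : ℝ}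

theorem exists_weakArray_of_isBigOPow (hY : ∀ n, ∀ i ∈ D n, Measurable (Y n i))
    (hmean : ∀ n, ∀ i ∈ D n, ∫ ω, Y n i ω ∂μ n = 0) (hm : 2 < m)
    (hint : ∀ n, ∀ i ∈ D n, Integrable (fun ω => |Y n i ω| ^ m) (μ n)) (hK : 0 ≤ K)
    (hmoment : ∀ n, ∀ i ∈ D n, ∫ ω, |Y n i ω| ^ m ∂μ n ≤ K)
    (hcov : ∀ᶠ n in atTop, CovControlled (μ n) (Y n) (pair n) κ w) (hκ : 0 ≤ κ) (hw : w ≤ 1)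
    (hd : 0 ≤ d) (hα : (m - 1) / (m - 2) * d < α)
    (h : ∀ u v : ℕ, u + v ≤ 4 → IsBigOPow (unifCoeff D pair u v) α) :
    ∃ p : ArrayParams, d < p.rate ∧ ∀ᶠ n in atTop, WeakArray p (μ n) (Y n) (D n) := by
  obtain ⟨C, s₀, hC, hs₀, hle⟩ := exists_pair_le_of_card_add_card_le h
  have hα₀ : 0 ≤ α := by
    refine le_trans (mul_nonneg (div_nonneg ?_ ?_) hd) hα.le <;> linarith
  refine ⟨⟨m, K, α, κ * C * 4, s₀, hm, hK, hα₀, by positivity, hs₀⟩, ?_, hcov.mono fun n hn =>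
    ⟨hY n, hmean n, hint n, hmoment n, fun U V hU hV hUV s hs hdist f g A A' L L' hf hg => ?_⟩⟩
  · rw [ArrayParams.rate, lt_div_iff₀ (by linarith)]
    rw [div_mul_eq_mul_div, div_lt_iff₀ (by linarith)] at hα
    linarith
  · have hs' : 0 ≤ s := zero_le_one.trans (hs₀.trans hs)
    have hU' : (U.card : ℝ) ≤ 4 := by exact_mod_cast (by omega : U.card ≤ 4)
    have hV' : (V.card : ℝ) ≤ 4 := by exact_mod_cast (by omega : V.card ≤ 4)
    have hA := hf.nonneg
    have hA' := hg.nonneg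
    have hL := hf.lip_nonneg
    have hL' := hg.lip_nonneg
    calc _ ≤ κ * (C * s ^ (-α)) * (w * (U.card * A' * L) + V.card * A * L') :=
          hn U V _ (by positivity) (hle n U hU V hV hUV s hs hdist) f g A A' L L' hf hg
      _ ≤ κ * (C * s ^ (-α)) * (1 * (4 * A' * L) + 4 * A * L') := by gcongr
      _ = _ := by ring

theorem exists_longRange_of_isBigOPow (hD : Tendsto (fun n => (D n).card) atTop atTop)
    (hcov : ∀ᶠ n in atTop, CovControlled (μ n) (Y n) (pair n) κ w) (hκ : 0 ≤ κ)
    (hw : w = 0 ∨ w = 1) (h : IsBigOPow (fun s => ⨆ u : ℕ, unifCoeff D pair u 1 s) β)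
    (hγ : 0 < γ) (hγβ : (1 + w) / 2 < γ * β) {T : ℝ} (hT : 0 ≤ T) (Λ : ℝ) :
    ∃ e : ℕ → ℝ, Tendsto (fun n => √(D n).card * e n) atTop (𝓝 0) ∧
      ∀ᶠ n in atTop, LongRange (μ n) (Y n) (D n) T ((D n).card ^ γ) (Λ / √(D n).card) (e n) := by
  have hw₀ : 0 ≤ w := by rcases hw with rfl | rfl <;> norm_num
  have hcard : Tendsto (fun n => ((D n).card : ℝ)) atTop atTop :=
    tendsto_natCast_atTop_atTop.comp hD
  obtain ⟨C, s₀, hC, -, hle⟩ := exists_pair_singleton_le h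
  refine ⟨fun n => κ * (C * ((D n).card ^ γ : ℝ) ^ (-β)) *
    (w * ((D n).card * T * (Λ / √(D n).card)) + 1), ?_, ?_⟩
  · have hrpow {q : ℝ} (hq : q < γ * β) :
        Tendsto (fun n => ((D n).card : ℝ) ^ (-(γ * β - q))) atTop (𝓝 0) :=
      (tendsto_rpow_neg_atTop (sub_pos.2 hq)).comp hcard
    have hlim := ((hrpow hγβ).const_mul (κ * C * w * T * Λ)).add
      ((hrpow (q := 1 / 2) (by linarith)).const_mul (κ * C))
    rw [mul_zero, mul_zero, add_zero] at hlim
    refine hlim.congr' ?_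
    filter_upwards [hcard.eventually_gt_atTop 0] with n hn
    have hpow (q : ℝ) : ((D n).card : ℝ) ^ (-(γ * β - q)) =
        ((D n).card ^ γ : ℝ) ^ (-β) * (D n).card ^ q := by
      rw [← Real.rpow_mul hn.le, ← Real.rpow_add hn]
      ring_nf
    have hweight : w * ((D n).card : ℝ) ^ ((1 + w) / 2) = w * (D n).card := by
      rcases hw with rfl | rfl <;> norm_num
    rw [hpow, hpow, ← Real.sqrt_eq_rpow]
    have hsqrt := (Real.sqrt_pos.2 hn).ne'
    field_simp
    linear_combination (κ * C * T * Λ) * hweight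
  · filter_upwards [hcov, ((tendsto_rpow_atTop hγ).comp hcard).eventually_ge_atTop s₀] with n hn hs
    exact hn.longRange hκ hw₀ hC hT (by positivity) (hle _ hs n)

end decay

section reduction

theorem tendstoInDistribution_gaussian_of_tendsto_charFun {Ω : ℕ → Type*}
    [∀ n, MeasurableSpace (Ω n)] {μ : ∀ n, Measure (Ω n)} [∀ n, IsProbabilityMeasure (μ n)]
    {W : ∀ n, Ω n → ℝ} (hW : ∀ n, AEMeasurable (W n) (μ n))
    (h : ∀ t : ℝ, Tendsto (fun n => charFun ((μ n).map (W n)) t) atTop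
      (𝓝 (Complex.exp (-(t : ℂ) ^ 2 / 2)))) :
    TendstoInDistribution W atTop (id : ℝ → ℝ) μ (gaussianReal 0 1) where
  forall_aemeasurable := hW
  aemeasurable_limit := aemeasurable_id
  tendsto := by
    refine ProbabilityMeasure.tendsto_iff_tendsto_charFun.2 fun t => ?_
    simp only [ProbabilityMeasure.coe_mk, Measure.map_id, charFun_gaussianReal]
    convert h t using 2
    push_cast
    ring_nf

theorem exists_pos_le_of_liminf_ofReal_pos {x : ℕ → ℝ}
    (h : 0 < liminf (fun n => ENNReal.ofReal (x n)) atTop) :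
    ∃ c : ℝ, 0 < c ∧ ∀ᶠ n in atTop, c ≤ x n := by
  obtain ⟨b, hb₀, hb⟩ := exists_between h
  have hb' : b ≠ ∞ := (hb.trans_le le_top).ne
  refine ⟨b.toReal, ENNReal.toReal_pos hb₀.ne' hb', ?_⟩
  filter_upwards [eventually_lt_of_lt_liminf hb] with n hn
  exact ((ENNReal.lt_ofReal_iff_toReal_lt hb').1 hn).le

theorem integrable_and_integral_le_of_lintegral_le {Ω : Type*} [MeasurableSpace Ω] {μ : Measure Ω}
    {F : Ω → ℝ} {K : ℝ} (hF : AEStronglyMeasurable F μ) (hF₀ : 0 ≤ F) (hK : 0 ≤ K)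
    (h : ∫⁻ ω, ENNReal.ofReal (F ω) ∂μ ≤ ENNReal.ofReal K) :
    Integrable F μ ∧ ∫ ω, F ω ∂μ ≤ K := by
  refine ⟨⟨hF, ?_⟩, ?_⟩
  · rw [hasFiniteIntegral_iff_ofReal (.of_forall hF₀)]
    exact h.trans_lt ENNReal.ofReal_lt_top
  · rw [integral_eq_lintegral_of_nonneg_ae (.of_forall hF₀) hF]
    exact ENNReal.toReal_le_of_le_ofReal hK h

variable {E : Type*} {D : ℕ → Finset E} {Ω : ℕ → Type*} [∀ n, MeasurableSpace (Ω n)]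
  {μ : ∀ n, Measure (Ω n)} {X : ∀ n, E → Ω n → ℝ} {c : ℕ → E → ℝ} {m w : ℝ}

theorem le_scale (c : ℕ → E → ℝ) {n : ℕ} {i : E} (hi : i ∈ D n) : c n i ≤ scale D c n :=
  le_ciSup (f := fun i : D n => c n i) (Set.finite_range _).bddAbove ⟨i, hi⟩

theorem exists_moment_bound (hX : ∀ n, ∀ i ∈ D n, Measurable (X n i)) (hm : 0 ≤ m)
    (hc : ∀ n, ∀ i ∈ D n, 0 < c n i)
    (hmoment : (⨆ (n : ℕ), ⨆ i ∈ D n,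
      ∫⁻ ω, ENNReal.ofReal (|X n i ω / c n i| ^ m) ∂μ n) < ∞) :
    ∃ K : ℝ, 0 ≤ K ∧ ∀ n, ∀ i ∈ D n,
      Integrable (fun ω => |(scale D c n)⁻¹ * X n i ω| ^ m) (μ n) ∧
        ∫ ω, |(scale D c n)⁻¹ * X n i ω| ^ m ∂μ n ≤ K := by
  refine ⟨_, ENNReal.toReal_nonneg, fun n i hi => integrable_and_integral_le_of_lintegral_le
    ?_ (fun ω => by positivity) ENNReal.toReal_nonneg
    (le_of_le_of_eq ?_ (ENNReal.ofReal_toReal hmoment.ne).symm)⟩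
  · have := hX n i hi
    fun_prop
  · refine le_iSup_of_le n (le_iSup₂_of_le i hi (lintegral_mono fun ω => ?_))
    have hpos := hc n i hi
    have hle := le_scale c hi
    have hscale : 0 < scale D c n := hpos.trans_le hle
    refine ENNReal.ofReal_le_ofReal (Real.rpow_le_rpow (abs_nonneg _) ?_ hm)
    rw [abs_mul, abs_div, abs_of_pos hpos, abs_of_pos (inv_pos.2 hscale), div_eq_inv_mul]
    gcongr

theorem exists_neighbourhood_exponent {d ρ β : ℝ} (hd : 0 ≤ d) (hw : 0 ≤ w) (hρ : d < ρ)
    (hβ : (1 + w) * d < β) :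
    ∃ b γ : ℝ, d < b ∧ b < ρ ∧ 0 < γ ∧ γ * b < 1 / 2 ∧ (1 + w) / 2 < γ * β := by
  obtain ⟨b, hdb, hb⟩ := exists_between (lt_min hρ ((lt_div_iff₀' (by positivity)).2 hβ))
  obtain ⟨hbρ, hbβ⟩ := lt_min_iff.1 hb
  rw [lt_div_iff₀' (by positivity)] at hbβ
  have hb₀ : 0 < b := hd.trans_lt hdb
  have hβ₀ : 0 < β := (mul_pos (by positivity) hb₀).trans hbβ
  obtain ⟨γ, hγ, hγ'⟩ := exists_between (a₁ := (1 + w) / 2 / β) (a₂ := 1 / 2 / b) (by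
    rw [div_lt_div_iff₀ hβ₀ hb₀]
    linarith)
  exact ⟨b, γ, hdb, hbρ, (by positivity : 0 < (1 + w) / 2 / β).trans hγ, (lt_div_iff₀ hb₀).1 hγ',
    (div_lt_iff₀ hβ₀).1 hγ⟩

variable [PseudoMetricSpace E] [∀ n, IsProbabilityMeasure (μ n)] {d : ℕ}
  {pair : ℕ → Finset E → Finset E → ℝ≥0∞} {c₀ κ : ℝ}

theorem tendsto_charFun_of_polyDecay {Y : ∀ n, E → Ω n → ℝ} {K : ℝ} (hgrowth : HasPolyGrowth D d)
    (hD : Tendsto (fun n => (D n).card) atTop atTop) (hY : ∀ n, ∀ i ∈ D n, Measurable (Y n i))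
    (hmean : ∀ n, ∀ i ∈ D n, ∫ ω, Y n i ω ∂μ n = 0) (hm : 2 < m) (hK : 0 ≤ K)
    (hmoment : ∀ n, ∀ i ∈ D n, Integrable (fun ω => |Y n i ω| ^ m) (μ n) ∧
      ∫ ω, |Y n i ω| ^ m ∂μ n ≤ K)
    (hcov : ∀ᶠ n in atTop, CovControlled (μ n) (Y n) (pair n) κ w) (hκ : 0 ≤ κ)
    (hw : w = 0 ∨ w = 1) (hc₀ : 0 < c₀)
    (hvar : ∀ᶠ n in atTop, c₀ * (D n).card ≤ Var[fun ω => ∑ i ∈ D n, Y n i ω; μ n])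
    (hdecay : PolyDecay (unifCoeff D pair) d m ((1 + w) * d)) (t : ℝ) :
    Tendsto (fun n => charFun ((μ n).map fun ω =>
      (√Var[fun ω => ∑ i ∈ D n, Y n i ω; μ n])⁻¹ * ∑ i ∈ D n, Y n i ω) t) atTop
      (𝓝 (Complex.exp (-(t : ℂ) ^ 2 / 2))) := by
  obtain ⟨⟨α, hα, hshort⟩, β, hβ, hlong⟩ := hdecay
  have hw₀ : 0 ≤ w := by rcases hw with rfl | rfl <;> norm_num
  have hw₁ : w ≤ 1 := by rcases hw with rfl | rfl <;> norm_num
  obtain ⟨p, hp, hweak⟩ := exists_weakArray_of_isBigOPow hY hmean hm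
    (fun n i hi => (hmoment n i hi).1) hK (fun n i hi => (hmoment n i hi).2) hcov hκ hw₁
    d.cast_nonneg hα hshort
  obtain ⟨b, γ, hdb, hb, hγ, hγb, hγβ⟩ :=
    exists_neighbourhood_exponent d.cast_nonneg hw₀ hp hβ
  obtain ⟨S, hS⟩ := hgrowth b hdb
  exact tendsto_charFun_of_weakArray hD hweak (d.cast_nonneg.trans hdb.le) hb hS hc₀ hvar hγ hγb
    (fun T hT Λ _ => exists_longRange_of_isBigOPow hD hcov hκ hw hlong hγ hγβ hT.le Λ) t

theorem tendstoInDistribution_of_covControlled (hgrowth : HasPolyGrowth D d)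
    (hD : Tendsto (fun n => (D n).card) atTop atTop) (hX : ∀ n, ∀ i ∈ D n, Measurable (X n i))
    (hmean : ∀ n, ∀ i ∈ D n, ∫ ω, X n i ω ∂μ n = 0) (hm : 2 < m)
    (hc : ∀ n, ∀ i ∈ D n, 0 < c n i)
    (hmoment : (⨆ (n : ℕ), ⨆ i ∈ D n,
      ∫⁻ ω, ENNReal.ofReal (|X n i ω / c n i| ^ m) ∂μ n) < ∞)
    (hscale : 0 < liminf (fun n => ENNReal.ofReal (scale D c n)) atTop)
    (hvar : 0 < liminf (fun n => ENNReal.ofReal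
      (Var[partialSum D X n; μ n] / ((D n).card * scale D c n ^ 2))) atTop)
    (hcov : ∀ n, CovControlled (μ n) (X n) (pair n) κ w) (hκ : 0 ≤ κ) (hw : w = 0 ∨ w = 1)
    (hdecay : PolyDecay (unifCoeff D pair) d m ((1 + w) * d)) :
    TendstoInDistribution
      (fun n ω => (√Var[partialSum D X n; μ n])⁻¹ * partialSum D X n ω)
      atTop (id : ℝ → ℝ) μ (gaussianReal 0 1) := by
  obtain ⟨M₀, hM₀, hM⟩ := exists_pos_le_of_liminf_ofReal_pos hscale
  obtain ⟨c₀, hc₀, hv⟩ := exists_pos_le_of_liminf_ofReal_pos hvar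
  obtain ⟨K, hK, hmomentY⟩ := exists_moment_bound hX (by linarith) hc hmoment
  have hw₀ : 0 ≤ w := by rcases hw with rfl | rfl <;> norm_num
  have hsum (n : ℕ) (ω : Ω n) :
      ∑ i ∈ D n, (scale D c n)⁻¹ * X n i ω = (scale D c n)⁻¹ * partialSum D X n ω :=
    (Finset.mul_sum _ _ _).symm
  have hvarY (n : ℕ) : Var[fun ω => ∑ i ∈ D n, (scale D c n)⁻¹ * X n i ω; μ n] =
      (scale D c n)⁻¹ ^ 2 * Var[partialSum D X n; μ n] := by
    simp_rw [hsum]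
    exact variance_const_mul _ _ _
  refine tendstoInDistribution_gaussian_of_tendsto_charFun (fun n =>
    ((Finset.measurable_fun_sum (D n) (hX n)).const_mul _).aemeasurable) fun t =>
    (tendsto_charFun_of_polyDecay (c₀ := c₀) hgrowth hD (fun n i hi => (hX n i hi).const_mul _)
      (fun n i hi => by rw [integral_const_mul, hmean n i hi, mul_zero]) hm hK hmomentY
      (hM.mono fun n hn => (hcov n).const_mul hκ hw₀ (inv_nonneg.2 (hM₀.le.trans hn))
        (inv_anti₀ hM₀ hn)) (by positivity) hw hc₀ ?_ hdecay t).congr' ?_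
  · filter_upwards [hv, hM, hD.eventually_gt_atTop 0] with n hvn hMn hn
    have hMn' := hM₀.trans_le hMn
    rw [hvarY, inv_pow, ← div_eq_inv_mul, le_div_iff₀ (by positivity)]
    rw [le_div_iff₀ (by positivity)] at hvn
    linarith
  · filter_upwards [hM] with n hMn
    have hMn' := hM₀.trans_le hMn
    simp_rw [hvarY, hsum, Real.sqrt_mul (sq_nonneg _), Real.sqrt_sq (inv_pos.2 hMn').le]
    congr! 3 with ω
    field_simp

end reduction

end WeakDep

end

theorem mainTheorem1_general
    {E : Type*} [PseudoMetricSpace E] (d : ℕ)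
    (D : ℕ → Finset E) (hgrowth : WeakDep.HasPolyGrowth D d)
    (hD : Tendsto (fun n => (D n).card) atTop atTop)
    {Ω : ℕ → Type*} [∀ n, MeasurableSpace (Ω n)]
    (μ : ∀ n, Measure (Ω n)) [∀ n, IsProbabilityMeasure (μ n)]
    (X : ∀ n, E → Ω n → ℝ) (hX : ∀ n, ∀ i ∈ D n, Measurable (X n i))
    (hmean : ∀ n, ∀ i ∈ D n, ∫ ω, X n i ω ∂(μ n) = 0)
    (m : ℝ) (hm : 2 < m)
    (c : ℕ → E → ℝ) (hc : ∀ n, ∀ i ∈ D n, 0 < c n i)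
    (hmoment : (⨆ (n : ℕ), ⨆ i ∈ D n,
      ∫⁻ ω, ENNReal.ofReal (|X n i ω / c n i| ^ m) ∂(μ n)) < ∞)
    (hscale : 0 < liminf (fun n => ENNReal.ofReal (WeakDep.scale D c n)) atTop)
    (hvar : 0 < liminf (fun n => ENNReal.ofReal
      (variance (WeakDep.partialSum D X n) (μ n) /
        ((D n).card * WeakDep.scale D c n ^ 2))) atTop)
    (hdep : WeakDep.PolyDecay (WeakDep.thetaBar μ D X) d m d ∨
      WeakDep.PolyDecay (WeakDep.etaBar μ D X) d m (2 * d)) :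
    TendstoInDistribution
      (fun n ω => (√(variance (WeakDep.partialSum D X n) (μ n)))⁻¹ * WeakDep.partialSum D X n ω)
      atTop (id : ℝ → ℝ) μ (gaussianReal 0 1) := by
  rcases hdep with hθ | hη
  · refine WeakDep.tendstoInDistribution_of_covControlled hgrowth hD hX hmean hm hc hmoment hscale
      hvar (fun n => WeakDep.covControlled_thetaPair (μ n) (X n)) zero_le_one (.inl rfl) ?_
    rwa [add_zero, one_mul]
  · refine WeakDep.tendstoInDistribution_of_covControlled hgrowth hD hX hmean hm hc hmoment hscale
      hvar (fun n => WeakDep.covControlled_etaPair (μ n) (X n)) zero_le_one (.inr rfl) ?_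
    rwa [one_add_one_eq_two]

theorem mainTheorem1
    {E : Type*} [NormedAddCommGroup E] [NormedSpace ℝ E] [FiniteDimensional ℝ E]
    (d : ℕ) (hd : 1 ≤ d) (hE : Module.finrank ℝ E = d)
    (L : Set E) (hL : WeakDep.IsLattice L)
    (D : ℕ → Finset E) (hDL : ∀ n, (D n : Set E) ⊆ L)
    (hD : Tendsto (fun n => (D n).card) atTop atTop)
    {Ω : ℕ → Type*} [∀ n, MeasurableSpace (Ω n)]
    (μ : ∀ n, Measure (Ω n)) [∀ n, IsProbabilityMeasure (μ n)]
    (X : ∀ n, E → Ω n → ℝ) (hX : ∀ n, ∀ i ∈ D n, Measurable (X n i))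
    (hmean : ∀ n, ∀ i ∈ D n, ∫ ω, X n i ω ∂(μ n) = 0)
    (m : ℝ) (hm : 2 < m)
    (c : ℕ → E → ℝ) (hc : ∀ n, ∀ i ∈ D n, 0 < c n i)
    (hmoment : (⨆ (n : ℕ), ⨆ i ∈ D n,
      ∫⁻ ω, ENNReal.ofReal (|X n i ω / c n i| ^ m) ∂(μ n)) < ∞)
    (hscale : 0 < liminf (fun n => ENNReal.ofReal (WeakDep.scale D c n)) atTop)
    (hvar : 0 < liminf (fun n => ENNReal.ofReal
      (variance (WeakDep.partialSum D X n) (μ n) /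
        ((D n).card * WeakDep.scale D c n ^ 2))) atTop)
    (hdep : WeakDep.PolyDecay (WeakDep.thetaBar μ D X) d m d ∨
      WeakDep.PolyDecay (WeakDep.etaBar μ D X) d m (2 * d)) :
    TendstoInDistribution
      (fun n ω => (√(variance (WeakDep.partialSum D X n) (μ n)))⁻¹ * WeakDep.partialSum D X n ω)
      atTop (id : ℝ → ℝ) μ (gaussianReal 0 1) := by
  obtain ⟨ρ₀, hρ₀, hsep⟩ := hL.separated
  exact mainTheorem1_general d D (hE ▸ WeakDep.hasPolyGrowth_of_separated hρ₀
    (fun i hi j hj => hsep i hi j hj) hDL) hD μ X hX hmean m hm c hc hmoment hscale hvar hdep
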